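/- Setting. Fix $p\in[0,1]$ and $d>0$. For a prime power $q$, an $[n,k]_q$-code consists of an encoder, which maps a message $u\in\mathbb F_q^{k}$ and a secret $r\in\mathbb F_q^{\ell}$ to a word $\mathbf x\in\mathbb F_q^n$, and a (possibly randomized) decoder, which maps a word $\mathbf y\in\mathbb F_q^n$ to a message. The secret is uniformly distributed and known only to the sender. A $d$-delay online overwrite adversary of power $p$ knows the code and may be randomized and computationally unbounded. For each position $i$ it decides, from the symbols $x_j$ with $j\le i-dn$ only, whether to leave $x_i$ unchanged ($y_i=x_i$) or to overwrite it by a symbol $e_i$ of its choice ($y_i=e_i$); for every transmitted codeword $\mathbf x$, the received word $\mathbf y$ differs from $\mathbf x$ in at most $pn$ positions. The probability of error of the code is the maximum, over all messages $u$ and all such adversaries, of the probability (over the secret and the randomness of the decoder and of the adversary) that the decoder does not output $u$. A rate $R\ge 0$ is achievable if for all $\varepsilon,\delta>0$ and every sufficiently large $n$ there are a prime power $q$ and an $[n,k]_q$-code with $k\ge n(R-\delta)$ and probability of error at most $\varepsilon$. The capacity $C_d^{\mathrm{ow}}(p)$ is the supremum of the achievable rates. Theorem. For every $p\in[0,1]$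 and $d>0$, $$C_d^{\mathrm{ow}}(p)=\begin{cases}1-p, & p<\tfrac12 \text{ and } p<d,\\ 1-2p+d, & d<p<\tfrac12,\\ 0, & p\ge\tfrac12.\end{cases}$$ Moreover, in each of these cases the capacity $C=C_d^{\mathrm{ow}}(p)$ is attained by efficient codes: for all $\varepsilon,\delta>0$ there are an encoding algorithm, a decoding algorithm and a constant $a$ such that for every sufficiently large $n$ there are a prime power $q$ with $2^n\le q\le 2^{n^a}$ and an $[n,k]_q$-code with $k\ge n(C-\delta)$ and probability of error at most $\varepsilon$ that uses at most $n^a$ random symbols on either side, and whose encoder and decoder are computed by the two algorithms (given $n$) in at most $n^a$ bit operations, i.e. in time at most $n^a$ on a random access machine with logarithmic cost. -/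

import Mathlib

/-! ## Codes and delayed overwrite jammers -/

namespace OnlineChannel

/-- A code of block length `n` over an alphabet with `q` symbols. The alphabet (the underlying set
of the field with `q` elements; overwrite errors do not use its arithmetic) is `Fin q`.
A message is a string of `k` symbols. The encoder uses a secret of `l` symbols, uniformly
distributed and known to Alice only; the decoder uses `b` uniformly distributed symbols of its
own (`b = 0` is a deterministic decoder). -/
structure Code (n q : ℕ) where
  k : ℕ
  l : ℕ
  b : ℕ
  enc : (Fin k → Fin q) → (Fin l → Fin q) → (Fin n → Fin q)
  dec : (Fin n → Fin q) → (Fin b → Fin q) → (Fin k → Fin q)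

/-- A deterministic jamming strategy: given the transmitted word, it says for each position
either `none` (the symbol is left alone) or `some e` (the symbol is overwritten by `e`). -/
abbrev Jammer (n q : ℕ) : Type := Fin n → (Fin n → Fin q) → Option (Fin q)

/-- The word that Bob receives. -/
def received {n q : ℕ} (J : Jammer n q) (x : Fin n → Fin q) : Fin n → Fin q :=
  fun i => (J i x).getD (x i)

/-- The action at position `i` depends only on the symbols `x j` with `j ≤ i - d n`. -/
def IsDelayed {n q : ℕ} (d : ℝ) (J : Jammer n q) : Prop :=
  ∀ (i : Fin n) (x x' : Fin n → Fin q),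
    (∀ j : Fin n, ((j : ℕ) : ℝ) ≤ ((i : ℕ) : ℝ) - d * n → x j = x' j) → J i x = J i x'

/-- Whatever is sent, at most `p n` received symbols differ from the transmitted ones. -/
def HasPower {n q : ℕ} (p : ℝ) (c : Code n q) (J : Jammer n q) : Prop :=
  ∀ (u : Fin c.k → Fin q) (r : Fin c.l → Fin q),
    (hammingDist (received J (c.enc u r)) (c.enc u r) : ℝ) ≤ p * n

/-- The probability, over the secret of Alice and the coins of Bob, that Bob decodes the message
`u` incorrectly when the strategy is `J`. -/
noncomputable def errorProbOf {n q : ℕ} (c : Code n q) (J : Jammer n q)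
    (u : Fin c.k → Fin q) : ℝ :=
  ((Finset.univ.filter fun z : (Fin c.l → Fin q) × (Fin c.b → Fin q) =>
      c.dec (received J (c.enc u z.1)) z.2 ≠ u).card : ℝ) /
    (Fintype.card ((Fin c.l → Fin q) × (Fin c.b → Fin q)) : ℝ)

/-- The probability of error for the message `u` when the strategy is itself drawn at random,
with the probabilities `w`. -/
noncomputable def errorProb {n q : ℕ} (c : Code n q) (w : Jammer n q → ℝ)
    (u : Fin c.k → Fin q) : ℝ :=
  ∑ J : Jammer n q, w J * errorProbOf c J u

/-- Against every randomized `d`-delay online overwrite jammer of power `p`, and for every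
message, the probability of error is at most `ε`. -/
def Code.Reliable {n q : ℕ} (c : Code n q) (p d ε : ℝ) : Prop :=
  ∀ w ∈ stdSimplex ℝ (Jammer n q),
    (∀ J, w J ≠ 0 → IsDelayed d J ∧ HasPower p c J) →
      ∀ u : Fin c.k → Fin q, errorProb c w u ≤ ε

/-- The rate `R` is achievable by some codes, with no bound on their complexity or on the size
of the alphabet. -/
def Achievable (p d R : ℝ) : Prop :=
  ∀ ε : ℝ, 0 < ε → ∀ δ : ℝ, 0 < δ → ∃ N : ℕ, ∀ n : ℕ, N ≤ n →
    ∃ q : ℕ, IsPrimePow q ∧ ∃ c : Code n q, (R - δ) * n ≤ c.k ∧ c.Reliable p d ε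

/-- `C` is the supremum of the achievable rates. -/
def IsCapacity (p d C : ℝ) : Prop :=
  IsLUB {R : ℝ | 0 ≤ R ∧ Achievable p d R} C

/-! ## Random access machines with logarithmic cost -/

/-- The memory: a natural number in each cell. -/
abbrev Mem : Type := ℕ → ℕ

/-- Expressions. `load a` is the content of the cell whose address is the value of `a`. -/
inductive Expr : Type
  | lit (v : ℕ)
  | load (a : Expr)
  | add (a b : Expr)
  | sub (a b : Expr)
  | mul (a b : Expr)
  | div (a b : Expr)

/-- The value of an expression (`sub` is truncated, division by zero gives zero). -/
def Expr.eval (m : Mem) : Expr → ℕ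
  | .lit v => v
  | .load a => m (a.eval m)
  | .add a b => a.eval m + b.eval m
  | .sub a b => a.eval m - b.eval m
  | .mul a b => a.eval m * b.eval m
  | .div a b => a.eval m / b.eval m

/-- The time for evaluating an expression: each operation is charged one unit plus the binary
lengths of the numbers (and addresses) it handles. -/
def Expr.cost (m : Mem) : Expr → ℕ
  | .lit v => 1 + v.size
  | .load a => a.cost m + (1 + (a.eval m).size + (m (a.eval m)).size)
  | .add a b => a.cost m + b.cost m + (1 + (a.eval m).size + (b.eval m).size)
  | .sub a b => a.cost m + b.cost m + (1 + (a.eval m).size + (b.eval m).size)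
  | .mul a b => a.cost m + b.cost m + (1 + (a.eval m).size + (b.eval m).size)
  | .div a b => a.cost m + b.cost m + (1 + (a.eval m).size + (b.eval m).size)

/-- Programs. `store a e` writes the value of `e` into the cell whose address is the value of
`a`; a test succeeds when its value is not zero. -/
inductive Prog : Type
  | skip
  | store (a e : Expr)
  | seq (s t : Prog)
  | ite (e : Expr) (s t : Prog)
  | while (e : Expr) (s : Prog)

/-- `Exec s m m' t`: started in memory `m`, the program `s` halts in memory `m'` after time
exactly `t`. -/
inductive Exec : Prog → Mem → Mem → ℕ → Prop
  | skip (m : Mem) : Exec .skip m m 1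
  | store (a e : Expr) (m : Mem) :
      Exec (.store a e) m (Function.update m (a.eval m) (e.eval m))
        (a.cost m + e.cost m + (1 + (a.eval m).size + (e.eval m).size))
  | seq {s s' : Prog} {m m' m'' : Mem} {t t' : ℕ} :
      Exec s m m' t → Exec s' m' m'' t' → Exec (.seq s s') m m'' (t + t')
  | ite_true {e : Expr} {s s' : Prog} {m m' : Mem} {t : ℕ} :
      e.eval m ≠ 0 → Exec s m m' t → Exec (.ite e s s') m m' (e.cost m + 1 + t)
  | ite_false {e : Expr} {s s' : Prog} {m m' : Mem} {t : ℕ} :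
      e.eval m = 0 → Exec s' m m' t → Exec (.ite e s s') m m' (e.cost m + 1 + t)
  | while_true {e : Expr} {s : Prog} {m m' m'' : Mem} {t t' : ℕ} :
      e.eval m ≠ 0 → Exec s m m' t → Exec (.while e s) m' m'' t' →
        Exec (.while e s) m m'' (e.cost m + 1 + t + t')
  | while_false {e : Expr} {s : Prog} {m : Mem} :
      e.eval m = 0 → Exec (.while e s) m m (e.cost m + 1)

/-- The program `s` maps the input list `xs`, placed in the cells `0, 1, …` of an otherwise zero
memory, to the output list `ys`, left in the cells `0, 1, …`, within time `T`. -/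
def Prog.ComputesWithin (s : Prog) (xs ys : List ℕ) (T : ℕ) : Prop :=
  ∃ (m : Mem) (t : ℕ), Exec s (fun a => xs.getD a 0) m t ∧ t ≤ T ∧
    ∀ i : ℕ, i < ys.length → m i = ys.getD i 0

/-- A word over the alphabet as a list of numbers. -/
def word {n q : ℕ} (x : Fin n → Fin q) : List ℕ := List.ofFn fun i => ((x i : Fin q) : ℕ)

/-- `E` and `D` encode and decode within time `T`. Besides its proper arguments a program is
given the block length only. -/
def Code.RunsIn {n q : ℕ} (c : Code n q) (E D : Prog) (T : ℕ) : Prop :=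
  (∀ (u : Fin c.k → Fin q) (r : Fin c.l → Fin q),
    E.ComputesWithin (n :: (word u ++ word r)) (word (c.enc u r)) T) ∧
  (∀ (y : Fin n → Fin q) (s : Fin c.b → Fin q),
    D.ComputesWithin (n :: (word y ++ word s)) (word (c.dec y s)) T)

/-- The rate `R` is achievable by efficient codes: one encoding program and one decoding program
serve all large block lengths `n`, in time polynomial in `n`, with polynomially many
random symbols, over an alphabet whose size is exponential in a polynomial in `n`. -/
def EfficientlyAchievable (p d R : ℝ) : Prop :=
  ∀ ε : ℝ, 0 < ε → ∀ δ : ℝ, 0 < δ → ∃ (E D : Prog) (a N : ℕ), ∀ n : ℕ, N ≤ n →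
    ∃ q : ℕ, IsPrimePow q ∧ 2 ^ n ≤ q ∧ q ≤ 2 ^ (n ^ a) ∧
      ∃ c : Code n q, (R - δ) * n ≤ c.k ∧ c.Reliable p d ε ∧
        c.l ≤ n ^ a ∧ c.b ≤ n ^ a ∧ c.RunsIn E D (n ^ a)

end OnlineChannel

/-! Converse. Let the jammer pass the first `L < k` symbols, overwrite the next `g` by zero, and
from then on pretend that some other word `x'` with the same prefix was sent, by overwriting either
the next `h` symbols or the remaining `h'` by those of `x'`. Sending `x` under the first attack with
`x'`, or `x'` under the second with `x`, yields the same word, so one of two different messages is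
decoded wrongly. Since `L < k`, most pairs with a common prefix carry different messages, and some
attack fails too often (`not_reliable`). The zeros bridge the delay: with `g` about `d n` the prefix
is known when the pretence starts. The budget `g + h ≈ g + h' ≈ p n` then gives `L ≈ (1 - 2p + d)
n`. Erasing the last `p n` symbols gives `1 - p`, and overwriting one half of the word gives zero
for `p ≥ 1/2`.

Codes. A message is a number `U`, and position `i` carries its residue modulo the `i`-th of `n`
coprime moduli, an integer analogue of a Reed–Solomon code. It also carries a random key and, hashed
with this key, tags of the residues at all positions. The alphabet is so large that keys and tags
cost a vanishing fraction of the rate. When the jammer overwrites position `i`, it does not know the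
keys at positions `j > i - d n`, so a false residue passes the tag check of such an unchanged `j`
only with small probability (`card_collides_le`). Outside a rare event, every unchanged position
therefore accepts exactly the correct residues among those near it.

The decoder calls `V` valid if about `(1 - p) n` positions agree with `V` and accept, near
themselves, exactly the residues of `V`. If `U` was sent and `V` is valid, the last position
supporting both forces the two to agree on everything near it. Counting what lies beyond gives about
`(1 - 2p + d) n` common residues (`card_inter_ge`), more than the message length, so `V = U`. The
last unchanged position accepts enough correct residues to recover `U` by the Chinese remainder
theorem, so `n` candidates suffice (`decode_eq`). A union bound finishes the analysis
(`code_reliable`).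

Efficiency. `Poly` is the class of functions with values of polynomially many bits that a program
computes in polynomial time. It is closed under arithmetic and under sums and products of polynomial
length (`Poly.accum`). Encoder and decoder are arithmetic formulas of this kind, and `Poly.output`
writes their values digit by digit. -/

namespace OnlineChannel

/-! ### Environments and polynomial bounds -/

/-- An environment: an initial memory together with finitely many loop indices. -/
class Env (α : Type) where
  mem : α → Mem
  arity : ℕ
  val : α → ℕ → ℕ

instance : Env (ℕ → ℕ) where
  mem m := m
  arity := 0
  val _ _ := 0

instance {α : Type} [Env α] : Env (α × ℕ) where
  mem e := Env.mem e.1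
  arity := Env.arity α + 1
  val e i := if i < Env.arity α then Env.val e.1 i else e.2

variable {α : Type} [Env α]

/-- The block length, which is kept in cell `0`. -/
def blk (e : α) : ℕ := Env.mem e 0

@[simp] theorem blk_prod (e : α × ℕ) : blk e = blk e.1 := rfl

/-- Cell contents have polynomially many bits and loop indices are polynomially bounded. -/
def Bdd (A : ℕ) (e : α) : Prop :=
  2 ≤ blk e ∧ (∀ a, (Env.mem e a).size ≤ blk e ^ A) ∧ ∀ i < Env.arity α, Env.val e i ≤ blk e ^ A

theorem Bdd.mono {A A' : ℕ} {e : α} (h : Bdd A e) (hA : A ≤ A') : Bdd A' e := by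
  have h1 : blk e ^ A ≤ blk e ^ A' := Nat.pow_le_pow_right (by have := h.1; omega) hA
  exact ⟨h.1, fun a => (h.2.1 a).trans h1, fun i hi => (h.2.2 i hi).trans h1⟩

theorem Bdd.ext {A i : ℕ} {e : α} (h : Bdd A e) (hi : i ≤ blk e ^ A) : Bdd A (e, i) := by
  refine ⟨h.1, h.2.1, fun j hj => ?_⟩
  by_cases hj' : j < Env.arity α
  · simpa [Env.val, hj'] using h.2.2 j hj'
  · simpa [Env.val, hj'] using hi

theorem Bdd.fst {A : ℕ} {e : α × ℕ} (h : Bdd A e) : Bdd A e.1 := by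
  refine ⟨h.1, h.2.1, fun j hj => ?_⟩
  have := h.2.2 j (Nat.lt_succ_of_lt hj)
  simpa [Env.val, hj] using this

theorem Bdd.snd {A : ℕ} {e : α × ℕ} (h : Bdd A e) : e.2 ≤ blk e.1 ^ A := by
  have := h.2.2 (Env.arity α) (Nat.lt_succ_self _)
  simpa [Env.val] using this

/-- `g` is polynomially bounded. -/
def PB (g : α → ℕ) : Prop := ∀ A, ∃ D, ∀ e, Bdd A e → g e ≤ blk e ^ D

theorem PB.of_le {f g : α → ℕ} (hg : PB g) (h : ∀ e, 2 ≤ blk e → f e ≤ g e) : PB f := fun A => by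
  obtain ⟨D, hD⟩ := hg A
  exact ⟨D, fun e he => (h e he.1).trans (hD e he)⟩

theorem PB.const (c : ℕ) : PB fun _ : α => c := fun _ =>
  -- A block length of at least two makes a power of it exceed any constant.
  ⟨c, fun _ he => (Nat.lt_two_pow_self (n := c)).le.trans (Nat.pow_le_pow_left he.1 c)⟩

theorem PB.blk : PB fun e : α => blk e := fun _ => ⟨1, fun _ _ => by simp⟩

theorem PB.add {f g : α → ℕ} (hf : PB f) (hg : PB g) : PB fun e => f e + g e := fun A => by
  obtain ⟨D, hD⟩ := hf A
  obtain ⟨D', hD'⟩ := hg A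
  refine ⟨max D D' + 1, fun e he => ?_⟩
  have h0 : 0 < OnlineChannel.blk e := by have := he.1; omega
  have h1 := (hD e he).trans (Nat.pow_le_pow_right h0 (le_max_left D D'))
  have h2 := (hD' e he).trans (Nat.pow_le_pow_right h0 (le_max_right D D'))
  rw [pow_succ]
  nlinarith [he.1]

theorem PB.mul {f g : α → ℕ} (hf : PB f) (hg : PB g) : PB fun e => f e * g e := fun A => by
  obtain ⟨D, hD⟩ := hf A
  obtain ⟨D', hD'⟩ := hg A
  exact ⟨D + D', fun e he => by rw [pow_add]; exact Nat.mul_le_mul (hD e he) (hD' e he)⟩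

theorem PB.fst {f : α → ℕ} (hf : PB f) : PB fun e : α × ℕ => f e.1 := fun A => by
  obtain ⟨D, hD⟩ := hf A
  exact ⟨D, fun e he => hD e.1 he.fst⟩

theorem PB.sum {N : α → ℕ} {f : α → ℕ → ℕ} (hN : PB N) (hf : PB fun e : α × ℕ => f e.1 e.2) :
    PB fun e => ∑ i ∈ Finset.range (N e), f e i := fun A => by
  obtain ⟨D, hD⟩ := hN A
  -- The new loop index may exceed `blk e ^ A`, so the bound on `f` is taken at a larger exponent.
  -- This is why `PB` quantifies over all `A`.
  obtain ⟨D', hD'⟩ := hf (max A D)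
  refine ⟨D + D', fun e he => ?_⟩
  have h0 : 0 < OnlineChannel.blk e := by have := he.1; omega
  have h : ∀ i ∈ Finset.range (N e), f e i ≤ OnlineChannel.blk e ^ D' := fun i hi => by
    refine hD' (e, i) ((he.mono (le_max_left _ _)).ext ?_)
    exact (Finset.mem_range.1 hi).le.trans ((hD e he).trans
      (Nat.pow_le_pow_right h0 (le_max_right _ _)))
  calc _ ≤ N e * OnlineChannel.blk e ^ D' := by simpa using Finset.sum_le_card_nsmul _ _ _ h
    _ ≤ _ := by rw [pow_add]; exact Nat.mul_le_mul_right _ (hD e he)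

theorem size_le_self (a : ℕ) : a.size ≤ a := Nat.size_le.2 Nat.lt_two_pow_self

theorem size_add_le (a b : ℕ) : (a + b).size ≤ a.size + b.size + 1 := by
  rw [Nat.size_le, pow_succ, pow_add]
  have h1 := Nat.lt_size_self a
  have h2 := Nat.lt_size_self b
  have h3 : 1 ≤ 2 ^ a.size := Nat.one_le_two_pow
  have h4 : 1 ≤ 2 ^ b.size := Nat.one_le_two_pow
  nlinarith

theorem size_mul_le (a b : ℕ) : (a * b).size ≤ a.size + b.size := by
  rw [Nat.size_le, pow_add]
  exact Nat.mul_lt_mul'' (Nat.lt_size_self a) (Nat.lt_size_self b)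

theorem PB.size {f : α → ℕ} (hf : PB f) : PB fun e => (f e).size :=
  hf.of_le fun e _ => size_le_self (f e)

/-! ### Memory layout -/

/-- Cells below `4 * m 0` hold `m`, the variables follow. -/
def lay (m v : Mem) : Mem := fun a => if a < 4 * m 0 then m a else v (a - 4 * m 0)

theorem lay_low {m v : Mem} {a : ℕ} (h : a < 4 * m 0) : lay m v a = m a := if_pos h

theorem lay_zero {m v : Mem} (h : 0 < m 0) : lay m v 0 = m 0 := lay_low (by omega)

/-- The address of the variable `c`. -/
def adr (c : ℕ) : Expr := .add (.mul (.lit 4) (.load (.lit 0))) (.lit c)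

/-- The value of the variable `c`. -/
def var (c : ℕ) : Expr := .load (adr c)

/-- The time for computing the address of the variable `c`. -/
def adrCost (c n : ℕ) : ℕ := (adr c).cost fun _ => n

theorem adr_eval {m v : Mem} (h : 0 < m 0) (c : ℕ) : (adr c).eval (lay m v) = 4 * m 0 + c := by
  simp [adr, Expr.eval, lay_zero h]

theorem var_eval {m v : Mem} (h : 0 < m 0) (c : ℕ) : (var c).eval (lay m v) = v c := by
  rw [var, Expr.eval, adr_eval h]
  simp [lay]

theorem adr_cost {m v : Mem} (h : 0 < m 0) (c : ℕ) :
    (adr c).cost (lay m v) = adrCost c (m 0) := by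
  simp [adr, adrCost, Expr.cost, Expr.eval, lay_zero h]

theorem var_cost {m v : Mem} (h : 0 < m 0) (c : ℕ) :
    (var c).cost (lay m v) = adrCost c (m 0) + (1 + (4 * m 0 + c).size + (v c).size) := by
  have h1 := var_eval (v := v) h c
  rw [var, Expr.eval, adr_eval h] at h1
  rw [var, Expr.cost, adr_cost h, adr_eval h, h1]

theorem update_lay {m v : Mem} (c x : ℕ) :
    Function.update (lay m v) (4 * m 0 + c) x = lay m (Function.update v c x) := by
  funext a
  by_cases h : a < 4 * m 0
  · rw [Function.update_of_ne (by omega)]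
    simp [lay, h]
  · by_cases h' : a = 4 * m 0 + c
    · subst h'; simp [lay]
    · rw [Function.update_of_ne h']
      simp only [lay, h, if_false]
      rw [Function.update_of_ne (by omega)]

theorem PB.adrCost (c : ℕ) : PB fun e : α => adrCost c (OnlineChannel.blk e) := by
  have h : PB fun e : α => 100 + OnlineChannel.blk e * 100 + c * 100 :=
    ((PB.const _).add (PB.blk.mul (PB.const _))).add (PB.const _)
  refine h.of_le fun e _ => ?_
  simp only [OnlineChannel.adrCost, adr, Expr.cost, Expr.eval]
  have h1 := size_le_self (OnlineChannel.blk e)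
  have h2 := size_le_self (4 * OnlineChannel.blk e)
  have h3 := size_le_self c
  have h4 := size_le_self 4
  have h5 := size_le_self 0
  omega

/-- Assignment to the variable `c`. -/
def set (c : ℕ) (e : Expr) : Prog := .store (adr c) e

theorem exec_set {m v : Mem} (h : 0 < m 0) (c : ℕ) {e : Expr} {x t : ℕ}
    (hx : e.eval (lay m v) = x) (ht : e.cost (lay m v) = t) :
    Exec (set c e) (lay m v) (lay m (Function.update v c x))
      (adrCost c (m 0) + t + (1 + (4 * m 0 + c).size + x.size)) := by
  have := Exec.store (adr c) e (lay m v)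
  rwa [adr_eval h, adr_cost h, update_lay, hx, ht] at this

theorem PB.adrSize (c : ℕ) : PB fun e : α => (4 * OnlineChannel.blk e + c).size :=
  PB.size (((PB.const _).mul PB.blk).add (PB.const _))

/-- The time for `set c E` when `E` takes time `t` and has the value `x`. -/
def setCost (c n t x : ℕ) : ℕ := adrCost c n + t + (1 + (4 * n + c).size + x.size)

theorem PB.setCost (c : ℕ) {t x : α → ℕ} (ht : PB t) (hx : PB fun e => (x e).size) :
    PB fun e => setCost c (OnlineChannel.blk e) (t e) (x e) :=
  ((PB.adrCost c).add ht).add (((PB.const _).add (PB.adrSize c)).add hx)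

/-- The time for reading the variable `c` with value `x`. -/
def varCost (c n x : ℕ) : ℕ := adrCost c n + (1 + (4 * n + c).size + x.size)

theorem PB.varCost (c : ℕ) {x : α → ℕ} (hx : PB fun e => (x e).size) :
    PB fun e => varCost c (OnlineChannel.blk e) (x e) :=
  (PB.adrCost c).add (((PB.const _).add (PB.adrSize c)).add hx)

/-! ### Functions computable in polynomial time -/

/-- The program `s` computes `f` within time `T`, leaving the result in the variable `c`, given the
loop indices in the variables `loc i`, without touching the variables below `c`. -/
def Implements (f T : α → ℕ) (c : ℕ) (loc : ℕ → ℕ) (s : Prog) : Prop :=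
  ∀ (e : α) (v : Mem), 0 < blk e → (∀ i < Env.arity α, v (loc i) = Env.val e i) →
    ∃ (v' : Mem) (t : ℕ), Exec s (lay (Env.mem e) v) (lay (Env.mem e) v') t ∧ t ≤ T e ∧
      (∀ i < c, v' i = v i) ∧ v' c = f e

/-- `f` is computable in polynomial time. -/
structure Poly (f : α → ℕ) : Prop where
  size : PB fun e => (f e).size
  run : ∀ (c : ℕ) (loc : ℕ → ℕ), (∀ i < Env.arity α, loc i < c) →
    ∃ (s : Prog) (T : α → ℕ), PB T ∧ Implements f T c loc s

/-- `f` is computable in polynomial time and its values are polynomially bounded. -/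
structure Small (f : α → ℕ) : Prop where
  poly : Poly f
  bound : PB f

theorem Poly.congr {f g : α → ℕ} (hf : Poly f) (h : ∀ e, f e = g e) : Poly g := by
  rwa [← funext h]

/-- Programs made of one assignment. -/
theorem Poly.of_set {f : α → ℕ} (hs : PB fun e => (f e).size)
    (h : ∀ (c : ℕ) (loc : ℕ → ℕ), (∀ i < Env.arity α, loc i < c) →
      ∃ (E : Expr) (T : α → ℕ), PB T ∧ ∀ (e : α) (v : Mem), 0 < blk e →
        (∀ i < Env.arity α, v (loc i) = Env.val e i) →
          E.eval (lay (Env.mem e) v) = f e ∧ E.cost (lay (Env.mem e) v) = T e) : Poly f := by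
  refine ⟨hs, fun c loc hloc => ?_⟩
  obtain ⟨E, T, hT, hE⟩ := h c loc hloc
  refine ⟨set c E, _, PB.setCost c hT hs, fun e v hn hv => ?_⟩
  obtain ⟨h1, h2⟩ := hE e v hn hv
  exact ⟨_, _, exec_set hn c h1 h2, le_rfl, fun i hi => Function.update_of_ne hi.ne _ _, by simp⟩

theorem Small.lit (a : ℕ) : Small fun _ : α => a :=
  ⟨Poly.of_set (PB.const _) fun _ _ _ => ⟨.lit a, _, PB.const (1 + a.size), fun _ _ _ _ =>
    ⟨rfl, rfl⟩⟩, PB.const _⟩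

theorem Small.blk : Small fun e : α => blk e := by
  refine ⟨Poly.of_set PB.blk.size fun _ _ _ => ⟨.load (.lit 0), _, ((PB.const (α := α)
    (1 + Nat.size 0 + (1 + Nat.size 0))).add PB.blk.size), fun e v hn _ => ?_⟩, PB.blk⟩
  simp [Expr.eval, Expr.cost, lay_zero hn, OnlineChannel.blk]
  omega

theorem Small.idx : Small fun e : α × ℕ => e.2 := by
  have hb : PB fun e : α × ℕ => e.2 := fun A => ⟨A, fun e he => he.snd⟩
  refine ⟨Poly.of_set hb.size fun c loc _ => ⟨var (loc (Env.arity α)), _,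
    PB.varCost (loc (Env.arity α)) hb.size, fun e v hn hv => ?_⟩, hb⟩
  have h := hv (Env.arity α) (Nat.lt_succ_self _)
  simp only [Env.val, lt_irrefl, if_false] at h
  rw [var_eval hn, var_cost hn, h]
  exact ⟨rfl, rfl⟩

theorem Poly.fst {f : α → ℕ} (hf : Poly f) : Poly fun e : α × ℕ => f e.1 := by
  refine ⟨hf.size.fst, fun c loc hloc => ?_⟩
  obtain ⟨s, T, hT, hs⟩ := hf.run c loc fun i hi => hloc i (Nat.lt_succ_of_lt hi)
  refine ⟨s, fun e => T e.1, hT.fst, fun e v hn hv => hs e.1 v hn fun i hi => ?_⟩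
  have := hv i (Nat.lt_succ_of_lt hi)
  simpa [Env.val, hi] using this

theorem Small.fst {f : α → ℕ} (hf : Small f) : Small fun e : α × ℕ => f e.1 :=
  ⟨hf.poly.fst, hf.bound.fst⟩

/-- A binary operation with its expression. -/
structure IsOp (ex : Expr → Expr → Expr) (op : ℕ → ℕ → ℕ) : Prop where
  eval : ∀ m a b, (ex a b).eval m = op (a.eval m) (b.eval m)
  cost : ∀ m a b, (ex a b).cost m =
    a.cost m + b.cost m + (1 + (a.eval m).size + (b.eval m).size)

theorem isOp_add : IsOp .add (· + ·) := ⟨fun _ _ _ => rfl, fun _ _ _ => rfl⟩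
theorem isOp_sub : IsOp .sub (· - ·) := ⟨fun _ _ _ => rfl, fun _ _ _ => rfl⟩
theorem isOp_mul : IsOp .mul (· * ·) := ⟨fun _ _ _ => rfl, fun _ _ _ => rfl⟩
theorem isOp_div : IsOp .div (· / ·) := ⟨fun _ _ _ => rfl, fun _ _ _ => rfl⟩

/-- The variables form a stack: the first operand is left in `c`, and the program for the second,
started at `c + 1`, preserves it. -/
theorem Poly.op {ex : Expr → Expr → Expr} {op : ℕ → ℕ → ℕ} (hop : IsOp ex op) {f g : α → ℕ}
    (hf : Poly f) (hg : Poly g) (hs : PB fun e => (op (f e) (g e)).size) :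
    Poly fun e => op (f e) (g e) := by
  refine ⟨hs, fun c loc hloc => ?_⟩
  obtain ⟨s, T, hT, hs1⟩ := hf.run c loc hloc
  obtain ⟨s', T', hT', hs2⟩ := hg.run (c + 1) loc fun i hi => Nat.lt_succ_of_lt (hloc i hi)
  refine ⟨.seq s (.seq s' (set c (ex (var c) (var (c + 1))))), _,
    hT.add (hT'.add (PB.setCost c (((PB.varCost c hf.size).add (PB.varCost (c + 1) hg.size)).add
      (((PB.const 1).add hf.size).add hg.size)) hs)), fun e v hn hv => ?_⟩
  obtain ⟨v1, t1, hx1, ht1, hk1, hr1⟩ := hs1 e v hn hv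
  obtain ⟨v2, t2, hx2, ht2, hk2, hr2⟩ := hs2 e v1 hn fun i hi => by rw [hk1 _ (hloc i hi), hv i hi]
  have h3 := hk2 c (Nat.lt_succ_self c)
  refine ⟨_, _, hx1.seq (hx2.seq (exec_set hn c (hop.eval _ _ _) (hop.cost _ _ _))), ?_,
    fun i hi => ?_, ?_⟩
  · rw [var_eval hn, var_eval hn, var_cost hn, var_cost hn, hr2, h3, hr1]
    have h4 : Env.mem e 0 = OnlineChannel.blk e := rfl
    simp only [setCost, varCost, h4]
    omega
  · rw [Function.update_of_ne hi.ne, hk2 i (Nat.lt_succ_of_lt hi), hk1 i hi]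
  · simp [var_eval hn, hr2, h3, hr1]

theorem Poly.add {f g : α → ℕ} (hf : Poly f) (hg : Poly g) : Poly fun e => f e + g e :=
  Poly.op isOp_add hf hg (((hf.size.add hg.size).add (PB.const 1)).of_le fun _ _ =>
    size_add_le _ _)

theorem Poly.sub {f g : α → ℕ} (hf : Poly f) (hg : Poly g) : Poly fun e => f e - g e :=
  Poly.op isOp_sub hf hg (hf.size.of_le fun _ _ => Nat.size_le_size (Nat.sub_le _ _))

theorem Poly.mul {f g : α → ℕ} (hf : Poly f) (hg : Poly g) : Poly fun e => f e * g e :=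
  Poly.op isOp_mul hf hg ((hf.size.add hg.size).of_le fun _ _ => size_mul_le _ _)

theorem Poly.div {f g : α → ℕ} (hf : Poly f) (hg : Poly g) : Poly fun e => f e / g e :=
  Poly.op isOp_div hf hg (hf.size.of_le fun _ _ => Nat.size_le_size (Nat.div_le_self _ _))

theorem Small.add {f g : α → ℕ} (hf : Small f) (hg : Small g) : Small fun e => f e + g e :=
  ⟨hf.1.add hg.1, hf.2.add hg.2⟩

theorem Small.mul {f g : α → ℕ} (hf : Small f) (hg : Small g) : Small fun e => f e * g e :=
  ⟨hf.1.mul hg.1, hf.2.mul hg.2⟩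

theorem Small.sub {f g : α → ℕ} (hf : Small f) (hg : Poly g) : Small fun e => f e - g e :=
  ⟨hf.1.sub hg, hf.2.of_le fun _ _ => Nat.sub_le _ _⟩

theorem Small.div {f g : α → ℕ} (hf : Small f) (hg : Poly g) : Small fun e => f e / g e :=
  ⟨hf.1.div hg, hf.2.of_le fun _ _ => Nat.div_le_self _ _⟩

theorem Small.pow {f : α → ℕ} (hf : Small f) (k : ℕ) : Small fun e => f e ^ k := by
  induction k with
  | zero => simpa using Small.lit (α := α) 1
  | succ k ih => simpa only [pow_succ] using ih.mul hf

/-- The formula also holds for the divisor zero, where the quotient is zero and the remainder is `f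
e`. -/
theorem Poly.mod {f g : α → ℕ} (hf : Poly f) (hg : Poly g) : Poly fun e => f e % g e :=
  (hf.sub ((hf.div hg).mul hg)).congr fun e => by
    have := Nat.div_add_mod (f e) (g e)
    rw [mul_comm] at this
    omega

/-- Reading the input. -/
theorem Poly.rd {f : α → ℕ} (hf : Poly f) :
    Poly fun e => Env.mem e (f e % (4 * OnlineChannel.blk e)) := by
  have hg : Poly fun e => f e % (4 * OnlineChannel.blk e) :=
    hf.mod ((Small.lit 4).mul Small.blk).poly
  have hs : PB fun e : α => (Env.mem e (f e % (4 * OnlineChannel.blk e))).size :=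
    fun A => ⟨A, fun e he => he.2.1 _⟩
  refine ⟨hs, fun c loc hloc => ?_⟩
  obtain ⟨s, T, hT, hs1⟩ := hg.run c loc hloc
  refine ⟨.seq s (set c (.load (var c))), _, hT.add (PB.setCost c ((PB.varCost c hg.size).add
    (((PB.const 1).add hg.size).add hs)) hs), fun e v hn hv => ?_⟩
  obtain ⟨v1, t1, hx1, ht1, hk1, hr1⟩ := hs1 e v hn hv
  -- Reduction modulo four block lengths keeps the address inside the input zone, away from the
  -- variables.
  have hl : lay (Env.mem e) v1 (v1 c) = Env.mem e (f e % (4 * OnlineChannel.blk e)) := by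
    rw [hr1]
    exact lay_low (Nat.mod_lt _ (by have : 0 < Env.mem e 0 := hn; change 0 < 4 * Env.mem e 0; omega))
  refine ⟨_, _, hx1.seq (exec_set hn c rfl rfl), ?_, fun i hi => ?_, ?_⟩
  · rw [hr1] at hl
    simp only [Expr.eval, Expr.cost, var_eval hn, var_cost hn, hr1, hl]
    have h4 : Env.mem e 0 = OnlineChannel.blk e := rfl
    simp only [setCost, varCost, h4]
    omega
  · rw [Function.update_of_ne hi.ne, hk1 i hi]
  · simp [Expr.eval, var_eval hn, hl]

/-- The accumulation of the values `f 0, …, f (j - 1)` by the operation `op`. -/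
def accum (op : ℕ → ℕ → ℕ) (a : ℕ) (f : ℕ → ℕ) : ℕ → ℕ
  | 0 => a
  | j + 1 => op (accum op a f j) (f j)

theorem accum_add (f : ℕ → ℕ) (j : ℕ) : accum (· + ·) 0 f j = ∑ i ∈ Finset.range j, f i := by
  induction j with
  | zero => rfl
  | succ j ih => rw [accum, ih, Finset.sum_range_succ]

theorem accum_mul (f : ℕ → ℕ) (j : ℕ) : accum (· * ·) 1 f j = ∏ i ∈ Finset.range j, f i := by
  induction j with
  | zero => rfl
  | succ j ih => rw [accum, ih, Finset.prod_range_succ]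

/-- A while loop with the bound in `c`, the accumulator in `c + 1`, the counter in `c + 2` and the
value of the body in `c + 3`. The counter serves as the new innermost index of the environment. The
bound on all partial results excludes growth as by repeated squaring; everything else follows from
`N` being polynomially bounded. -/
theorem Poly.accum {ex : Expr → Expr → Expr} {op : ℕ → ℕ → ℕ} (hop : IsOp ex op) (a : ℕ)
    {N : α → ℕ} {f : α → ℕ → ℕ} (hN : Small N) (hf : Poly fun e : α × ℕ => f e.1 e.2)
    {S : α → ℕ} (hS : PB S) (hsz : ∀ e, ∀ j ≤ N e, (accum op a (f e) j).size ≤ S e) :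
    Poly fun e => accum op a (f e) (N e) := by
  have hsf : PB fun e => (OnlineChannel.accum op a (f e) (N e)).size :=
    hS.of_le fun e _ => hsz e _ le_rfl
  refine ⟨hsf, fun c loc hloc => ?_⟩
  obtain ⟨sN, TN, hTN, hsN⟩ := hN.poly.run c loc hloc
  obtain ⟨sb, Tb, hTb, hsb⟩ := hf.run (c + 3)
    (fun i => if i < Env.arity α then loc i else c + 2) (fun i hi => by
      show (if i < Env.arity α then loc i else c + 2) < c + 3
      split
      · next h => have := hloc i h; omega
      · omega)
  have hFs : PB fun e => ∑ i ∈ Finset.range (N e), (f e i).size := PB.sum hN.bound hf.size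
  have hTs : PB fun e => ∑ i ∈ Finset.range (N e), Tb (e, i) := PB.sum hN.bound hTb
  let SS : α → ℕ := fun e => S e + ∑ i ∈ Finset.range (N e), (f e i).size + N e
  have hSS : PB SS := (hS.add hFs).add hN.bound
  let V : ℕ → α → ℕ := fun c e => adrCost c (OnlineChannel.blk e) +
    (1 + (4 * OnlineChannel.blk e + c).size + SS e)
  have hV : ∀ c, PB (V c) := fun c => (PB.adrCost c).add (((PB.const 1).add (PB.adrSize c)).add hSS)
  -- A generous bound for one round: every access to a variable costs at most some `V`, and the
  -- total time of all bodies replaces that of the current one.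
  let K : α → ℕ := fun e => (V c e + V (c + 1) e + V (c + 2) e + V (c + 3) e) * 10 + 10 * SS e + 10 +
    ∑ i ∈ Finset.range (N e), Tb (e, i)
  have hK : PB K := ((((((hV c).add (hV (c + 1))).add (hV (c + 2))).add (hV (c + 3))).mul
    (PB.const 10)).add ((PB.const 10).mul hSS) |>.add (PB.const 10)).add hTs
  let body : Prog := .seq sb (.seq (set (c + 1) (ex (var (c + 1)) (var (c + 3))))
    (set (c + 2) (.add (var (c + 2)) (.lit 1))))
  let loop : Prog := .while (.sub (var c) (var (c + 2))) body
  -- Induction on the number `r` of rounds that remain.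
  have hloop : ∀ (e : α) (r : ℕ) (v : Mem), 0 < OnlineChannel.blk e → r ≤ N e →
      (∀ i < Env.arity α, v (loc i) = Env.val e i) → v c = N e →
      v (c + 1) = OnlineChannel.accum op a (f e) (N e - r) → v (c + 2) = N e - r →
      ∃ (v' : Mem) (t : ℕ), Exec loop (lay (Env.mem e) v) (lay (Env.mem e) v') t ∧
        t ≤ (r + 1) * K e ∧ (∀ i < c, v' i = v i) ∧
        v' (c + 1) = OnlineChannel.accum op a (f e) (N e) := by
    intro e r
    induction r with
    | zero =>
      intro v hn _ hv hc h1 h2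
      refine ⟨v, _, Exec.while_false ?_, ?_, fun _ _ => rfl, by simpa using h1⟩
      · simp [Expr.eval, var_eval hn, hc, h2]
      · have h4 : Env.mem e 0 = OnlineChannel.blk e := rfl
        simp only [Expr.cost, var_eval hn, var_cost hn, hc, h2, K, V, SS, h4, Nat.sub_zero]
        have := size_le_self (N e)
        omega
    | succ r ih =>
      intro v hn hr hv hc h1 h2
      have h4 : Env.mem e 0 = OnlineChannel.blk e := rfl
      have hlt : N e - (r + 1) < N e := by omega
      have hsucc : N e - (r + 1) + 1 = N e - r := by omega
      obtain ⟨v1, t1, hx1, ht1, hk1, hr1⟩ := hsb (e, N e - (r + 1)) v hn (fun i hi => by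
        by_cases hi' : i < Env.arity α
        · simpa [Env.val, hi'] using hv i hi'
        · simpa [Env.val, hi'] using h2)
      have hx2 := exec_set (m := Env.mem e) (v := v1) hn (c + 1)
        (hop.eval _ (var (c + 1)) (var (c + 3))) (hop.cost _ (var (c + 1)) (var (c + 3)))
      have hacc : op (v1 (c + 1)) (v1 (c + 3)) = OnlineChannel.accum op a (f e) (N e - r) := by
        rw [hk1 (c + 1) (by omega), hr1, h1, ← hsucc]; rfl
      simp only [var_eval hn, hacc] at hx2
      set v2 := Function.update v1 (c + 1) (OnlineChannel.accum op a (f e) (N e - r)) with hv2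
      have hx3 := exec_set (m := Env.mem e) (v := v2) hn (c + 2)
        (e := .add (var (c + 2)) (.lit 1)) rfl rfl
      have h22 : v2 (c + 2) = N e - (r + 1) := by
        rw [hv2, Function.update_of_ne (by omega), hk1 _ (by omega), h2]
      simp only [Expr.eval, var_eval hn, h22, hsucc] at hx3
      set v3 := Function.update v2 (c + 2) (N e - r) with hv3
      have hlow : ∀ i < c + 1, v3 i = v i := fun i hi => by
        rw [hv3, Function.update_of_ne (by omega), hv2, Function.update_of_ne (by omega),
          hk1 i (by omega)]
      obtain ⟨v4, t4, hx4, ht4, hk4, hr4⟩ := ih v3 hn (by omega)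
        (fun i hi => by rw [hlow _ (Nat.lt_succ_of_lt (hloc i hi)), hv i hi])
        (by rw [hlow c (by omega), hc])
        (by rw [hv3, Function.update_of_ne (by omega), hv2, Function.update_self])
        (by rw [hv3, Function.update_self])
      refine ⟨v4, _, Exec.while_true ?_ (hx1.seq (hx2.seq hx3)) hx4, ?_, fun i hi => by
        rw [hk4 i hi, hlow i (by omega)], hr4⟩
      · simp [Expr.eval, var_eval hn, hc, h2]; omega
      · have e1 : t1 ≤ ∑ i ∈ Finset.range (N e), Tb (e, i) := ht1.trans
          (Finset.single_le_sum (f := fun i => Tb (e, i)) (fun _ _ => Nat.zero_le _)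
            (Finset.mem_range.2 hlt))
        have e2 : (f e (N e - (r + 1))).size ≤ ∑ i ∈ Finset.range (N e), (f e i).size :=
          Finset.single_le_sum (f := fun i => (f e i).size) (fun _ _ => Nat.zero_le _)
            (Finset.mem_range.2 hlt)
        have e3 := hsz e (N e - r) (by omega)
        have e4 := hsz e (N e - (r + 1)) (by omega)
        have e5 := size_le_self (N e)
        have e6 := size_le_self (N e - r)
        have e7 := size_le_self (N e - (r + 1))
        have e8 := size_le_self 1
        have hr1' : v1 (c + 3) = f e (N e - (r + 1)) := hr1
        have e9 : v1 (c + 1) = OnlineChannel.accum op a (f e) (N e - (r + 1)) := by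
          rw [hk1 (c + 1) (by omega), h1]
        rw [add_mul (r + 1) 1, one_mul]
        refine (Nat.add_le_add_left ht4 _).trans ?_
        rw [add_comm ((r + 1) * K e)]
        refine Nat.add_le_add_right ?_ _
        simp only [Expr.cost, Expr.eval, var_eval hn, var_cost hn, hc, h2, h22, e9, hr1', K, V, SS,
          h4]
        omega
  let C0 : α → ℕ := fun e => TN e + (setCost (c + 1) (OnlineChannel.blk e) (1 + a.size) a +
    (setCost (c + 2) (OnlineChannel.blk e) (1 + Nat.size 0) 0 + ((N e + 1) * K e +
    setCost c (OnlineChannel.blk e) (varCost (c + 1) (OnlineChannel.blk e) (OnlineChannel.accum op a (f e) (N e)))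
      (OnlineChannel.accum op a (f e) (N e)))))
  have hC0 : PB C0 := hTN.add ((PB.setCost _ (PB.const _) (PB.const _)).add
    ((PB.setCost _ (PB.const _) (PB.const _)).add (((hN.bound.add (PB.const 1)).mul hK).add
      (PB.setCost c (PB.varCost _ hsf) hsf))))
  refine ⟨.seq sN (.seq (set (c + 1) (.lit a)) (.seq (set (c + 2) (.lit 0)) (.seq loop
    (set c (var (c + 1)))))), C0, hC0, fun e v hn hv => ?_⟩
  obtain ⟨v1, t1, hx1, ht1, hk1, hr1⟩ := hsN e v hn hv
  have hx2 := exec_set (m := Env.mem e) (v := v1) hn (c + 1) (e := .lit a) rfl rfl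
  simp only [Expr.eval, Expr.cost] at hx2
  set v2 := Function.update v1 (c + 1) a with hv2
  have hx3 := exec_set (m := Env.mem e) (v := v2) hn (c + 2) (e := .lit 0) rfl rfl
  simp only [Expr.eval, Expr.cost] at hx3
  set v3 := Function.update v2 (c + 2) 0 with hv3
  have hlow : ∀ i < c + 1, v3 i = v1 i := fun i hi => by
    rw [hv3, Function.update_of_ne (by omega), hv2, Function.update_of_ne (by omega)]
  obtain ⟨v4, t4, hx4, ht4, hk4, hr4⟩ := hloop e (N e) v3 hn le_rfl
    (fun i hi => by rw [hlow _ (Nat.lt_succ_of_lt (hloc i hi)), hk1 _ (hloc i hi), hv i hi])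
    (by rw [hlow c (by omega), hr1])
    (by rw [hv3, Function.update_of_ne (by omega), hv2, Function.update_self]; simp [OnlineChannel.accum])
    (by rw [hv3, Function.update_self]; simp)
  have hx5 := exec_set (m := Env.mem e) (v := v4) hn c (e := var (c + 1)) rfl rfl
  rw [var_eval hn, var_cost hn, hr4] at hx5
  refine ⟨_, _, hx1.seq (hx2.seq (hx3.seq (hx4.seq hx5))), ?_, fun i hi => ?_, ?_⟩
  · have h4 : Env.mem e 0 = OnlineChannel.blk e := rfl
    simp only [C0, setCost, varCost, h4]
    omega
  · rw [Function.update_of_ne hi.ne, hk4 i hi, hlow i (by omega), hk1 i hi]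
  · simp

theorem Poly.sum {N : α → ℕ} {f : α → ℕ → ℕ} (hN : Small N)
    (hf : Poly fun e : α × ℕ => f e.1 e.2) : Poly fun e => ∑ i ∈ Finset.range (N e), f e i := by
  have h := Poly.accum isOp_add 0 hN hf
    (S := fun e => ∑ i ∈ Finset.range (N e), ((f e i).size + 1))
    (PB.sum hN.bound (hf.size.add (PB.const 1))) (fun e j hj => by
      have h1 : (OnlineChannel.accum (· + ·) 0 (f e) j).size ≤
          ∑ i ∈ Finset.range j, ((f e i).size + 1) := by
        clear hj
        induction j with
        | zero => simp [OnlineChannel.accum]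
        | succ j ih =>
          rw [Finset.sum_range_succ, OnlineChannel.accum]
          have := size_add_le (OnlineChannel.accum (· + ·) 0 (f e) j) (f e j)
          omega
      exact h1.trans (Finset.sum_le_sum_of_subset (Finset.range_mono hj)))
  exact h.congr fun e => accum_add _ _

theorem Poly.prod {N : α → ℕ} {f : α → ℕ → ℕ} (hN : Small N)
    (hf : Poly fun e : α × ℕ => f e.1 e.2) : Poly fun e => ∏ i ∈ Finset.range (N e), f e i := by
  have h := Poly.accum isOp_mul 1 hN hf
    (S := fun e => 1 + ∑ i ∈ Finset.range (N e), (f e i).size)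
    ((PB.const 1).add (PB.sum hN.bound hf.size)) (fun e j hj => by
      have h1 : (OnlineChannel.accum (· * ·) 1 (f e) j).size ≤
          1 + ∑ i ∈ Finset.range j, (f e i).size := by
        clear hj
        induction j with
        | zero => simp [OnlineChannel.accum]
        | succ j ih =>
          rw [Finset.sum_range_succ, OnlineChannel.accum]
          have := size_mul_le (OnlineChannel.accum (· * ·) 1 (f e) j) (f e j)
          omega
      exact h1.trans (Nat.add_le_add_left
        (Finset.sum_le_sum_of_subset (Finset.range_mono hj)) _))
  exact h.congr fun e => accum_mul _ _

theorem Poly.pow {f g : α → ℕ} (hf : Poly f) (hg : Small g) : Poly fun e => f e ^ g e :=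
  (Poly.prod (f := fun e _ => f e) hg hf.fst).congr fun e => by simp

theorem Poly.factorial {f : α → ℕ} (hf : Small f) : Poly fun e => (f e).factorial :=
  (Poly.prod hf (Small.idx.add (Small.lit 1)).poly).congr fun _ =>
    Finset.prod_range_add_one_eq_factorial _

/-! ### Predicates as functions with values zero and one -/

theorem small_bool {P : α → Prop} [∀ e, Decidable (P e)] {f : α → ℕ} (hf : Poly f)
    (h : ∀ e, f e = if P e then 1 else 0) : Small fun e => if P e then 1 else 0 :=
  ⟨hf.congr h, (PB.const 1).of_le fun e _ => by split <;> simp⟩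

theorem Small.lt {f g : α → ℕ} (hf : Poly f) (hg : Poly g) :
    Small fun e => if f e < g e then 1 else 0 :=
  small_bool ((Small.lit 1).poly.sub ((Small.lit 1).poly.sub (hg.sub hf))) fun e => by
    split <;> omega

theorem Small.eq {f g : α → ℕ} (hf : Poly f) (hg : Poly g) :
    Small fun e => if f e = g e then 1 else 0 :=
  small_bool ((Small.lit 1).poly.sub ((hg.sub hf).add (hf.sub hg))) fun e => by
    split <;> omega

theorem Small.not {P : α → Prop} [∀ e, Decidable (P e)]
    (h : Small fun e => if P e then 1 else 0) : Small fun e => if ¬ P e then 1 else 0 :=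
  small_bool ((Small.lit 1).sub h.poly).poly fun e => by by_cases hP : P e <;> simp [hP]

theorem Small.and {P R : α → Prop} [∀ e, Decidable (P e)] [∀ e, Decidable (R e)]
    (h : Small fun e => if P e then 1 else 0) (h' : Small fun e => if R e then 1 else 0) :
    Small fun e => if P e ∧ R e then 1 else 0 :=
  small_bool (h.mul h').poly fun e => by
    by_cases hP : P e <;> by_cases hR : R e <;> simp [hP, hR]

theorem Small.iff {P R : α → Prop} [∀ e, Decidable (P e)] [∀ e, Decidable (R e)]
    (h : Small fun e => if P e then 1 else 0) (h' : Small fun e => if R e then 1 else 0) :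
    Small fun e => if P e ↔ R e then 1 else 0 :=
  small_bool (Small.eq h.poly h'.poly).poly fun e => by
    by_cases hP : P e <;> by_cases hR : R e <;> simp [hP, hR]

theorem Small.all {N : α → ℕ} {P : α → ℕ → Prop} [∀ e i, Decidable (P e i)] (hN : Small N)
    (h : Small fun e : α × ℕ => if P e.1 e.2 then 1 else 0) :
    Small fun e => if ∀ i < N e, P e i then 1 else 0 :=
  small_bool (Poly.prod (f := fun e i => if P e i then 1 else 0) hN h.poly) fun e => by
    rw [Finset.prod_ite_zero]
    simp

/-- Both branches are evaluated and weighted by the indicator, so no conditional jump is needed. -/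
theorem Poly.ite {P : α → Prop} [∀ e, Decidable (P e)] {f g : α → ℕ}
    (h : Small fun e => if P e then 1 else 0) (hf : Poly f) (hg : Poly g) :
    Poly fun e => if P e then f e else g e :=
  ((h.poly.mul hf).add (h.not.poly.mul hg)).congr fun e => by by_cases hP : P e <;> simp [hP]

/-! ### Writing the digits of a number -/

theorem eq_lay (m : Mem) : lay m (fun a => m (a + 4 * m 0)) = m := by
  funext a
  unfold lay
  split
  · rfl
  · exact congrArg m (by omega)

theorem sub_div_mul_eq_mod (a b : ℕ) : a - a / b * b = a % b := by
  have := Nat.div_add_mod a b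
  rw [mul_comm] at this
  omega

theorem update_lay_low {m v : Mem} {a x : ℕ} (ha : 0 < a) (h : a < 4 * m 0) :
    Function.update (lay m v) a x = lay (Function.update m a x) v := by
  funext b
  have h0 : Function.update m a x 0 = m 0 := Function.update_of_ne ha.ne _ _
  by_cases hb : b = a
  · subst hb; simp [lay, h, h0]
  · rw [Function.update_of_ne hb]
    simp only [lay, h0]
    rw [Function.update_of_ne hb]

/-- A polynomial-time program that leaves the base `q` digits of `X` in the first cells. -/
theorem Poly.output {X q cnt : Mem → ℕ} (hX : Poly X) (hq : Poly q) (hc : Small cnt) :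
    ∃ E : Prog, ∀ A, ∃ D, ∀ m : Mem, Bdd A m → cnt m ≤ m 0 →
      ∃ (m' : Mem) (t : ℕ), Exec E m m' t ∧ t ≤ m 0 ^ D ∧
        ∀ i < cnt m, m' i = X m / q m ^ i % q m := by
  obtain ⟨sX, TX, hTX, hsX⟩ := hX.run 0 id (fun i hi => absurd hi (Nat.not_lt_zero i))
  obtain ⟨sq, Tq, hTq, hsq⟩ := hq.run 1 id (fun i hi => absurd hi (Nat.not_lt_zero i))
  obtain ⟨sc, Tc, hTc, hsc⟩ := hc.poly.run 2 id (fun i hi => absurd hi (Nat.not_lt_zero i))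
  let S : Mem → ℕ := fun m => (X m).size + (q m).size + cnt m
  have hS : PB S := (hX.size.add hq.size).add hc.bound
  let V : ℕ → Mem → ℕ := fun c m => adrCost c (blk m) + (1 + (4 * blk m + c).size + S m)
  have hV : ∀ c, PB (V c) := fun c => (PB.adrCost c).add (((PB.const 1).add (PB.adrSize c)).add hS)
  let K : Mem → ℕ := fun m => (V 0 m + V 1 m + V 2 m + V 3 m + V 4 m) * 20 + 20 * S m + 40
  have hK : PB K := (((((((hV 0).add (hV 1)).add (hV 2)).add (hV 3)).add (hV 4)).mul
    (PB.const 20)).add ((PB.const 20).mul hS)).add (PB.const 40)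
  let modE : ℕ → Expr := fun c => .sub (var c) (.mul (.div (var c) (var 1)) (var 1))
  let body : Prog := .seq (.store (var 3) (modE 4)) (.seq (set 4 (.div (var 4) (var 1)))
    (set 3 (.add (var 3) (.lit 1))))
  let loop : Prog := .while (.sub (var 2) (var 3)) body
  have hloop : ∀ (m : Mem) (r : ℕ) (w v : Mem), 0 < m 0 → cnt m ≤ m 0 → w 0 = m 0 → r < cnt m →
      v 0 = X m → v 1 = q m → v 2 = cnt m → v 3 = cnt m - r → v 4 = X m / q m ^ (cnt m - r) →
      (∀ i, 0 < i → i < cnt m - r → w i = X m / q m ^ i % q m) →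
      ∃ (w' v' : Mem) (t : ℕ), Exec loop (lay w v) (lay w' v') t ∧ t ≤ (r + 1) * K m ∧
        w' 0 = m 0 ∧ v' 0 = X m ∧ v' 1 = q m ∧
        ∀ i, 0 < i → i < cnt m → w' i = X m / q m ^ i % q m := by
    intro m r
    induction r with
    | zero =>
      intro w v hn hcn hw _ h0 h1 h2 h3 _ hd
      have hn' : 0 < w 0 := hw ▸ hn
      refine ⟨w, v, _, Exec.while_false ?_, ?_, hw, h0, h1, by simpa using hd⟩
      · simp [Expr.eval, var_eval hn', h2, h3]
      · have h5 : m 0 = blk m := rfl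
        simp only [Expr.cost, var_eval hn', var_cost hn', h2, h3, K, V, S, hw, h5, Nat.sub_zero]
        have := size_le_self (cnt m)
        omega
    | succ r ih =>
      intro w v hn hcn hw hr h0 h1 h2 h3 h4 hd
      have hn' : 0 < w 0 := hw ▸ hn
      have h5 : m 0 = blk m := rfl
      set j := cnt m - (r + 1) with hj
      have hj1 : cnt m - r = j + 1 := by omega
      have hj0 : 0 < j := by omega
      set Y := X m / q m ^ j with hY
      have hYq : Y / q m = X m / q m ^ (j + 1) := by rw [hY, Nat.div_div_eq_div_mul, pow_succ]
      have hx1 := Exec.store (var 3) (modE 4) (lay w v)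
      have hmod : (modE 4).eval (lay w v) = Y % q m := by
        simp only [modE, Expr.eval, var_eval hn', h1, h4, sub_div_mul_eq_mod]
      rw [hmod, var_eval hn', h3, update_lay_low hj0 (by omega)] at hx1
      set w1 := Function.update w j (Y % q m) with hw1
      have hw10 : w1 0 = m 0 := by rw [hw1, Function.update_of_ne hj0.ne, hw]
      have hn1 : 0 < w1 0 := hw10 ▸ hn
      have hx2 := exec_set (m := w1) (v := v) hn1 4 (e := .div (var 4) (var 1)) rfl rfl
      simp only [Expr.eval, Expr.cost, var_eval hn1, var_cost hn1, h1, h4, hYq] at hx2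
      set v2 := Function.update v 4 (X m / q m ^ (j + 1)) with hv2
      have h23 : v2 3 = j := by rw [hv2, Function.update_of_ne (by omega), h3]
      have hx3 := exec_set (m := w1) (v := v2) hn1 3 (e := .add (var 3) (.lit 1)) rfl rfl
      simp only [Expr.eval, Expr.cost, var_eval hn1, var_cost hn1, h23] at hx3
      set v3 := Function.update v2 3 (j + 1) with hv3
      have hlow : ∀ i < 3, v3 i = v i := fun i hi => by
        rw [hv3, Function.update_of_ne (by omega), hv2, Function.update_of_ne (by omega)]
      obtain ⟨w4, v4, t4, hx4, ht4, hres⟩ := ih w1 v3 hn hcn hw10 (by omega)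
        (by rw [hlow 0 (by omega), h0]) (by rw [hlow 1 (by omega), h1])
        (by rw [hlow 2 (by omega), h2]) (by rw [hv3, Function.update_self, hj1])
        (by rw [hv3, Function.update_of_ne (by omega), hv2, Function.update_self, hj1])
        (fun i hi hij => by
          by_cases hi' : i = j
          · rw [hi', hw1, Function.update_self]
          · rw [hw1, Function.update_of_ne hi']
            exact hd i hi (by omega))
      refine ⟨w4, v4, _, Exec.while_true ?_ (hx1.seq (hx2.seq hx3)) hx4, ?_, hres⟩
      · simp only [Expr.eval, var_eval hn', h2, h3]; omega
      · rw [add_mul (r + 1) 1, one_mul]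
        refine (Nat.add_le_add_left ht4 _).trans ?_
        rw [add_comm ((r + 1) * K m)]
        refine Nat.add_le_add_right ?_ _
        have e1 : Y.size ≤ (X m).size := Nat.size_le_size (Nat.div_le_self _ _)
        have e2 : (X m / q m ^ (j + 1)).size ≤ (X m).size := Nat.size_le_size (Nat.div_le_self _ _)
        have e3 : (Y / q m * q m).size ≤ (X m).size :=
          (Nat.size_le_size (Nat.div_mul_le_self _ _)).trans e1
        have e4 : (Y % q m).size ≤ (X m).size := (Nat.size_le_size (Nat.mod_le _ _)).trans e1
        have e5 := size_le_self j
        have e6 := size_le_self (j + 1)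
        have e7 := size_le_self (cnt m)
        have e8 := size_le_self 1
        rw [hYq] at e3
        simp only [Expr.cost, Expr.eval, modE, var_eval hn', var_cost hn', h1, h2, h3, h4, hYq,
          K, V, S, hw, hw10, h5]
        omega
  let C0 : Mem → ℕ := fun m => TX m + (Tq m + (Tc m +
    (setCost 3 (blk m) (1 + Nat.size 1) 1 + (10 * K m + ((cnt m + 1) * K m + 20 * K m)))))
  have hC0 : PB C0 := hTX.add (hTq.add (hTc.add ((PB.setCost _ (PB.const _) (PB.const _)).add
    (((PB.const 10).mul hK).add (((hc.bound.add (PB.const 1)).mul hK).add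
      ((PB.const 20).mul hK))))))
  -- Cell `0` holds the block length, from which the addresses of all variables are computed. Hence
  -- the loop starts with digit one, and digit zero is stored last.
  refine ⟨.seq sX (.seq sq (.seq sc (.seq (set 3 (.lit 1)) (.seq (set 4 (.div (var 0) (var 1)))
    (.seq loop (.store (.lit 0) (modE 0))))))), fun A => ?_⟩
  obtain ⟨D, hD⟩ := hC0 A
  refine ⟨D, fun m hm hcn => ?_⟩
  have hn : 0 < m 0 := by have : 2 ≤ m 0 := hm.1; omega
  have h5 : m 0 = blk m := rfl
  obtain ⟨v1, t1, hx1, ht1, hk1, hr1⟩ := hsX m (fun a => m (a + 4 * m 0)) hn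
    (fun i hi => absurd hi (Nat.not_lt_zero i))
  obtain ⟨v2, t2, hx2, ht2, hk2, hr2⟩ := hsq m v1 hn (fun i hi => absurd hi (Nat.not_lt_zero i))
  obtain ⟨v3, t3, hx3, ht3, hk3, hr3⟩ := hsc m v2 hn (fun i hi => absurd hi (Nat.not_lt_zero i))
  simp only [Env.mem] at hx1 hx2 hx3
  rw [eq_lay] at hx1
  have hx4 := exec_set (m := m) (v := v3) hn 3 (e := .lit 1) rfl rfl
  simp only [Expr.eval, Expr.cost] at hx4
  set v4 := Function.update v3 3 1 with hv4
  have h40 : v4 0 = X m := by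
    rw [hv4, Function.update_of_ne (by omega), hk3 0 (by omega), hk2 0 (by omega), hr1]
  have h41 : v4 1 = q m := by rw [hv4, Function.update_of_ne (by omega), hk3 1 (by omega), hr2]
  have h42 : v4 2 = cnt m := by rw [hv4, Function.update_of_ne (by omega), hr3]
  have h43 : v4 3 = 1 := by rw [hv4, Function.update_self]
  have hx5 := exec_set (m := m) (v := v4) hn 4 (e := .div (var 0) (var 1)) rfl rfl
  simp only [Expr.eval, Expr.cost, var_eval hn, var_cost hn, h40, h41] at hx5
  set v5 := Function.update v4 4 (X m / q m) with hv5
  have hlow : ∀ i < 4, v5 i = v4 i := fun i hi => by rw [hv5, Function.update_of_ne (by omega)]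
  have hfin : ∃ (w' v' : Mem) (t : ℕ), Exec loop (lay m v5) (lay w' v') t ∧
      t ≤ (cnt m + 1) * K m ∧ w' 0 = m 0 ∧ v' 0 = X m ∧ v' 1 = q m ∧
      ∀ i, 0 < i → i < cnt m → w' i = X m / q m ^ i % q m := by
    by_cases hc0 : cnt m = 0
    · refine ⟨m, v5, _, Exec.while_false ?_, ?_, rfl, by rw [hlow 0 (by omega), h40],
        by rw [hlow 1 (by omega), h41], fun i _ hi => by omega⟩
      · simp [Expr.eval, var_eval hn, hlow, h42, hc0]
      · simp only [Expr.cost, var_eval hn, var_cost hn, hlow 2 (by omega), hlow 3 (by omega), h42,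
          h43, hc0, K, V, S, h5]
        have := size_le_self 1
        have := size_le_self 0
        omega
    · obtain ⟨w', v', t, h1, h2, h3⟩ := hloop m (cnt m - 1) m v5 hn hcn rfl (by omega)
        (by rw [hlow 0 (by omega), h40]) (by rw [hlow 1 (by omega), h41])
        (by rw [hlow 2 (by omega), h42]) (by rw [hlow 3 (by omega), h43]; omega)
        (by rw [hv5, Function.update_self, show cnt m - (cnt m - 1) = 1 by omega, pow_one])
        (fun i hi hi' => by omega)
      exact ⟨w', v', t, h1, h2.trans (Nat.mul_le_mul_right _ (by omega)), h3⟩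
  obtain ⟨w, v6, t6, hx6, ht6, hw0, h60, h61, hdig⟩ := hfin
  have hnw : 0 < w 0 := hw0 ▸ hn
  have hx7 := Exec.store (.lit 0) (modE 0) (lay w v6)
  have hmod : (modE 0).eval (lay w v6) = X m % q m := by
    simp only [modE, Expr.eval, var_eval hnw, h60, h61, sub_div_mul_eq_mod]
  refine ⟨_, _, hx1.seq (hx2.seq (hx3.seq (hx4.seq (hx5.seq (hx6.seq hx7))))),
    le_trans ?_ (hD m hm), fun i hi => ?_⟩
  · have e1 : (X m / q m).size ≤ (X m).size := Nat.size_le_size (Nat.div_le_self _ _)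
    have e3 : (X m / q m * q m).size ≤ (X m).size :=
      Nat.size_le_size (Nat.div_mul_le_self _ _)
    have e4 : (X m % q m).size ≤ (X m).size := Nat.size_le_size (Nat.mod_le _ _)
    have e5 := size_le_self 0
    have e6 : setCost 3 (blk m) (1 + Nat.size 1) 1 =
      adrCost 3 (blk m) + (1 + Nat.size 1) + (1 + (4 * blk m + 3).size + Nat.size 1) := rfl
    have e7 : K m = (V 0 m + V 1 m + V 2 m + V 3 m + V 4 m) * 20 + 20 * S m + 40 := rfl
    have e8 : C0 m = TX m + (Tq m + (Tc m + (setCost 3 (blk m) (1 + Nat.size 1) 1 +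
      (10 * K m + ((cnt m + 1) * K m + 20 * K m))))) := rfl
    have hV0 : V 0 m = adrCost 0 (blk m) + (1 + (4 * blk m + 0).size + S m) := rfl
    have hV1 : V 1 m = adrCost 1 (blk m) + (1 + (4 * blk m + 1).size + S m) := rfl
    have hV4 : V 4 m = adrCost 4 (blk m) + (1 + (4 * blk m + 4).size + S m) := rfl
    have hSm : S m = (X m).size + (q m).size + cnt m := rfl
    rw [hmod, e8, e6]
    simp only [Expr.cost, Expr.eval, modE, var_eval hnw, var_cost hnw, h60, h61, hw0, h5]
    clear_value K V S C0
    generalize (cnt m + 1) * K m = z at ht6 ⊢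
    omega
  · rw [hmod]
    by_cases hi0 : i = 0
    · subst hi0; simp [Expr.eval]
    · simp only [Expr.eval]
      rw [Function.update_of_ne hi0, lay_low (by omega)]
      exact hdig i (by omega) hi

/-! ### The converse -/

theorem Code.Reliable.errorProbOf_le {n q : ℕ} {c : Code n q} {p d ε : ℝ} (h : c.Reliable p d ε)
    {J : Jammer n q} (hd : IsDelayed d J) (hp : HasPower p c J) (u : Fin c.k → Fin q) :
    errorProbOf c J u ≤ ε := by
  classical
  have := h (Pi.single J 1) (single_mem_stdSimplex ℝ J) (fun J' hJ' => by
    by_cases hJJ : J' = J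
    · exact hJJ ▸ ⟨hd, hp⟩
    · simp [hJJ] at hJ') u
  simpa [errorProb, Pi.single_apply] using this

theorem Code.reliable_of_forall {n q : ℕ} {c : Code n q} {p d ε : ℝ}
    (h : ∀ J : Jammer n q, IsDelayed d J → HasPower p c J → ∀ u, errorProbOf c J u ≤ ε) :
    c.Reliable p d ε := by
  intro w hw hJ u
  calc errorProb c w u ≤ ∑ J : Jammer n q, w J * ε := by
        refine Finset.sum_le_sum fun J _ => ?_
        by_cases h0 : w J = 0
        · simp [h0]
        · exact mul_le_mul_of_nonneg_left (h J (hJ J h0).1 (hJ J h0).2 u) (hw.1 J)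
    _ = ε := by rw [← Finset.sum_mul, hw.2, one_mul]

section Converse

variable {n q : ℕ} (L g h : ℕ)

/-- The word equal to `x` outside `[L, L + g + h)`, to zero on `[L, L + g)` and to `x'` on the
remaining positions. -/
def mix [NeZero q] (x x' : Fin n → Fin q) : Fin n → Fin q := fun i =>
  if (i : ℕ) < L then x i else if (i : ℕ) < L + g then 0 else if (i : ℕ) < L + g + h then x' i
  else x i

/-- The first `L` symbols. -/
def pre (x : Fin n → Fin q) : Fin L → Option (Fin q) := fun j =>
  if hj : (j : ℕ) < n then some (x ⟨j, hj⟩) else none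

/-- The jammer that erases `[L, L + g)` and then overwrites either the next `h` positions or the
positions after these by a word depending on the first `L` symbols. -/
def attack [NeZero q] (b : Bool) (f : (Fin L → Option (Fin q)) → (Fin n → Fin q)) : Jammer n q := fun i x =>
  if (i : ℕ) < L then none else if (i : ℕ) < L + g then some 0
  else if (decide ((i : ℕ) < L + g + h) = b) then some (f (pre L x) i) else none

theorem pre_eq_iff {x x' : Fin n → Fin q} :
    pre L x = pre L x' ↔ ∀ i : Fin n, (i : ℕ) < L → x i = x' i := by
  constructor
  · intro hx i hi
    have := congrFun hx ⟨i, hi⟩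
    simpa [pre] using this
  · intro hx
    funext j
    by_cases hj : (j : ℕ) < n
    · simpa [pre, hj] using hx ⟨j, hj⟩ j.2
    · simp [pre, hj]

theorem received_attack_true [NeZero q] (f : (Fin L → Option (Fin q)) → (Fin n → Fin q))
    (x : Fin n → Fin q) : received (attack L g h true f) x = mix L g h x (f (pre L x)) := by
  funext i
  simp only [received, attack, mix]
  split_ifs <;> simp_all

/-- Because `f` returns a word with the prefix it was given, this is the word produced by the other
attack with the two words exchanged: the source of the confusion. -/
theorem received_attack_false [NeZero q] (f : (Fin L → Option (Fin q)) → (Fin n → Fin q))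
    (x : Fin n → Fin q) (hf : pre L (f (pre L x)) = pre L x) :
    received (attack L g h false f) x = mix L g h (f (pre L x)) x := by
  rw [pre_eq_iff] at hf
  funext i
  simp only [received, attack, mix]
  split_ifs <;> simp_all

/-- Actions before `L + g` are constant; all later ones use only the prefix, which is old enough by
then. -/
theorem isDelayed_attack [NeZero q] (b : Bool) (f : (Fin L → Option (Fin q)) → (Fin n → Fin q)) {d : ℝ}
    (hd : ∀ i j : ℕ, L + g ≤ i → i < n → j < L → (j : ℝ) ≤ i - d * n) :
    IsDelayed d (attack L g h b f) := by
  intro i x x' hx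
  by_cases h1 : (i : ℕ) < L + g
  · simp [attack, h1]
  · have : pre L x = pre L x' := (pre_eq_iff L).2 fun j hj =>
      hx j (hd i j (not_lt.1 h1) i.2 hj)
    simp [attack, this]

theorem hasPower_attack [NeZero q] (b : Bool) (f : (Fin L → Option (Fin q)) → (Fin n → Fin q)) {p : ℝ}
    {h' : ℕ} (hn : L + g + h + h' = n) (h1 : ((g + h : ℕ) : ℝ) ≤ p * n)
    (h2 : ((g + h' : ℕ) : ℝ) ≤ p * n) (c : Code n q) : HasPower p c (attack L g h b f) := by
  intro u r
  set x := c.enc u r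
  have key : ∀ T : Finset ℕ, (∀ i : Fin n, received (attack L g h b f) x i ≠ x i → (i : ℕ) ∈ T) →
      hammingDist (received (attack L g h b f) x) x ≤ T.card := fun T hT => by
    rw [hammingDist]
    refine Finset.card_le_card_of_injOn (fun i : Fin n => (i : ℕ)) (fun i hi => ?_)
      Fin.val_injective.injOn
    exact hT i (by simpa using hi)
  cases b with
  | true =>
    refine le_trans ?_ h1
    norm_cast
    refine (key (Finset.Ico L (L + g + h)) fun i hi => ?_).trans (by simp; omega)
    rw [Finset.mem_Ico]
    by_contra hcon
    apply hi
    by_cases hL : (i : ℕ) < L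
    · simp [received, attack, hL]
    · have h3 : ¬ (i : ℕ) < L + g := by omega
      have h4 : ¬ (i : ℕ) < L + g + h := by omega
      simp [received, attack, hL, h3, h4]
  | false =>
    refine le_trans ?_ h2
    norm_cast
    refine (key (Finset.Ico L (L + g) ∪ Finset.Ico (L + g + h) n) fun i hi => ?_).trans
      ((Finset.card_union_le _ _).trans (by simp; omega))
    rw [Finset.mem_union, Finset.mem_Ico, Finset.mem_Ico]
    by_contra hcon
    apply hi
    have := i.2
    by_cases hL : (i : ℕ) < L
    · simp [received, attack, hL]
    · have h3 : ¬ (i : ℕ) < L + g := by omega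
      have h4 : (i : ℕ) < L + g + h := by omega
      simp [received, attack, hL, h3, h4]

/-- Double counting of decoding failures under the two attacks. Messages are confused within a class
of equal prefixes; there are at most `q ^ L` classes, and a message occurs at most `q ^ l` times in
each. So the two failure probabilities add up to at least `1 - q ^ L / q ^ k ≥ 1 / 2`, whereas
reliability allows `1 / 4`. -/
theorem not_reliable [NeZero q] {h' : ℕ} (hq : 2 ≤ q) (c : Code n q) {p d : ℝ} (hn : L + g + h + h' = n)
    (h1 : ((g + h : ℕ) : ℝ) ≤ p * n) (h2 : ((g + h' : ℕ) : ℝ) ≤ p * n)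
    (hd : ∀ i j : ℕ, L + g ≤ i → i < n → j < L → (j : ℝ) ≤ i - d * n) (hk : L + 1 ≤ c.k) :
    ¬ c.Reliable p d (1 / 8) := by
  classical
  intro hrel
  let X : (Fin c.k → Fin q) × (Fin c.l → Fin q) → (Fin n → Fin q) := fun z => c.enc z.1 z.2
  let wr : (Fin n → Fin q) → (Fin c.k → Fin q) → ℝ := fun y u =>
    ((Finset.univ.filter fun s : Fin c.b → Fin q => c.dec y s ≠ u).card : ℝ)
  let fib : (Fin L → Option (Fin q)) → Finset ((Fin c.k → Fin q) × (Fin c.l → Fin q)) := fun v =>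
    Finset.univ.filter fun z => pre L (X z) = v
  let N : (Fin c.k → Fin q) × (Fin c.l → Fin q) → (Fin n → Fin q) → ℝ := fun z x' =>
    wr (mix L g h (X z) x') z.1 + wr (mix L g h x' (X z)) z.1
  have hwr : ∀ y u u', u ≠ u' → (q : ℝ) ^ c.b ≤ wr y u + wr y u' := by
    intro y u u' hu
    have h3 : (Finset.univ : Finset (Fin c.b → Fin q)) ⊆
        (Finset.univ.filter fun s => c.dec y s ≠ u) ∪
        (Finset.univ.filter fun s => c.dec y s ≠ u') := fun s _ => by
      simp only [Finset.mem_union, Finset.mem_filter, Finset.mem_univ, true_and]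
      by_contra! hcon
      exact hu (hcon.1.symm.trans hcon.2)
    have h4 := (Finset.card_le_card h3).trans (Finset.card_union_le _ _)
    simp only [Finset.card_univ, Fintype.card_fun, Fintype.card_fin] at h4
    simp only [wr]
    exact_mod_cast h4
  have hwr0 : ∀ y u, 0 ≤ wr y u := fun y u => Nat.cast_nonneg _
  -- the words in a fiber are confused with one of them
  have hfib : ∀ v, ∃ x' : Fin n → Fin q, ((fib v).Nonempty → pre L x' = v) ∧
      (((fib v).card : ℝ) - q ^ c.l) * q ^ c.b ≤ ∑ z ∈ fib v, N z x' := by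
    intro v
    by_cases hne : (fib v).Nonempty
    swap
    · rw [Finset.not_nonempty_iff_eq_empty] at hne
      refine ⟨fun _ => 0, fun h => absurd hne h.ne_empty, ?_⟩
      rw [hne]
      simp only [Finset.card_empty, Nat.cast_zero, zero_sub, Finset.sum_empty, neg_mul,
        Left.neg_nonpos_iff]
      positivity
    have hpair : ∑ z' ∈ fib v, (((fib v).card : ℝ) - q ^ c.l) * q ^ c.b ≤
        ∑ z' ∈ fib v, ∑ z ∈ fib v, N z (X z') := by
      -- Exchanging the names `z` and `z'` in the second summand brings together the failures of
      -- both messages on one received word; by `hwr` these exhaust the decoder's coins when the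
      -- messages differ.
      have hswap : ∑ z' ∈ fib v, ∑ z ∈ fib v, N z (X z') = ∑ z' ∈ fib v, ∑ z ∈ fib v,
          (wr (mix L g h (X z) (X z')) z.1 + wr (mix L g h (X z) (X z')) z'.1) := by
        simp only [N, Finset.sum_add_distrib]
        congr 1
        exact Finset.sum_comm
      rw [hswap]
      refine Finset.sum_le_sum fun z' _ => ?_
      have h5 : ∑ z ∈ fib v, (if z.1 ≠ z'.1 then (q : ℝ) ^ c.b else 0) ≤ ∑ z ∈ fib v,
          (wr (mix L g h (X z) (X z')) z.1 + wr (mix L g h (X z) (X z')) z'.1) := by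
        refine Finset.sum_le_sum fun z _ => ?_
        split
        · next hz => exact hwr _ _ _ hz
        · exact add_nonneg (hwr0 _ _) (hwr0 _ _)
      refine le_trans ?_ h5
      rw [← Finset.sum_filter, Finset.sum_const, nsmul_eq_mul]
      refine mul_le_mul_of_nonneg_right ?_ (by positivity)
      have h6 := Finset.card_filter_add_card_filter_not (s := fib v) (fun z => z.1 ≠ z'.1)
      -- Pairs with the message of `z'` are determined by their secret.
      have h7 : ((fib v).filter fun z => ¬ z.1 ≠ z'.1).card ≤ q ^ c.l := by
        have : Fintype.card (Fin c.l → Fin q) = q ^ c.l := by simp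
        rw [← this]
        refine Finset.card_le_card_of_injOn (t := Finset.univ) (fun z => z.2)
          (fun _ _ => Finset.mem_coe.2 (Finset.mem_univ _)) fun z hz w hw hzw => ?_
        simp only [ne_eq, not_not, Finset.coe_filter, Set.mem_ofPred_eq] at hz hw
        exact Prod.ext (hz.2.trans hw.2.symm) hzw
      have h8 : ((fib v).card : ℝ) ≤ ((fib v).filter fun z => z.1 ≠ z'.1).card + (q : ℝ) ^ c.l := by
        rw [← h6]
        push_cast
        gcongr
        exact_mod_cast h7
      linarith
    -- Averaging over `z'` makes the choice of the false word deterministic.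
    obtain ⟨z', hz', hle⟩ := Finset.exists_le_of_sum_le hne hpair
    exact ⟨X z', fun _ => (Finset.mem_filter.1 hz').2, hle⟩
  choose f hf1 hf2 using hfib
  have hfX : ∀ z, pre L (f (pre L (X z))) = pre L (X z) := fun z =>
    hf1 _ ⟨z, by simp [fib]⟩
  have hqpos : (0 : ℝ) < q := by exact_mod_cast (by omega : 0 < q)
  -- lower bound for the total number of failures
  have hlow : ((q : ℝ) ^ (c.k + c.l) - q ^ L * q ^ c.l) * q ^ c.b ≤ ∑ z, N z (f (pre L (X z))) := by
    have hV : ∀ z, pre L (X z) ∈ Finset.univ.image (fun z => pre L (X z)) := fun z =>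
      Finset.mem_image_of_mem _ (Finset.mem_univ z)
    have hcardV : ((Finset.univ.image fun z => pre L (X z)).card : ℝ) ≤ (q : ℝ) ^ L := by
      have : (Finset.univ.image fun z => pre L (X z)).card ≤ (Finset.univ.image
          fun w : Fin L → Fin q => fun j => some (w j)).card := by
        refine Finset.card_le_card fun v hv => ?_
        obtain ⟨z, -, rfl⟩ := Finset.mem_image.1 hv
        refine Finset.mem_image.2 ⟨fun j => X z ⟨j, by have := j.2; omega⟩, Finset.mem_univ _, ?_⟩
        funext j
        have : (j : ℕ) < n := by have := j.2; omega
        simp [pre, this]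
      have h2 := this.trans Finset.card_image_le
      simp only [Finset.card_univ, Fintype.card_fun, Fintype.card_fin] at h2
      exact_mod_cast h2
    have hsum : ∑ v ∈ Finset.univ.image (fun z => pre L (X z)), ∑ z ∈ fib v,
        N z (f (pre L (X z))) = ∑ z, N z (f (pre L (X z))) :=
      Finset.sum_fiberwise_of_maps_to (fun z _ => hV z) _
    have hcs : ∑ v ∈ Finset.univ.image (fun z => pre L (X z)), ((fib v).card : ℝ) =
        (q : ℝ) ^ (c.k + c.l) := by
      have := Finset.card_eq_sum_card_fiberwise (s := Finset.univ)
        (t := Finset.univ.image (fun z => pre L (X z))) (f := fun z => pre L (X z))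
        (fun z _ => hV z)
      simp only [Finset.card_univ, Fintype.card_prod, Fintype.card_fun, Fintype.card_fin] at this
      rw [pow_add]
      exact_mod_cast this.symm
    rw [← hsum]
    calc _ ≤ ∑ v ∈ Finset.univ.image (fun z => pre L (X z)),
          (((fib v).card : ℝ) - q ^ c.l) * q ^ c.b := by
          rw [← Finset.sum_mul, Finset.sum_sub_distrib, hcs, Finset.sum_const, nsmul_eq_mul]
          gcongr
      _ ≤ _ := by
          refine Finset.sum_le_sum fun v _ => (hf2 v).trans (le_of_eq ?_)
          refine Finset.sum_congr rfl fun z hz => ?_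
          rw [(Finset.mem_filter.1 hz).2]
  -- upper bound from reliability
  have herr : ∀ (b : Bool) (u : Fin c.k → Fin q),
      ∑ r, wr (received (attack L g h b f) (c.enc u r)) u ≤ 1 / 8 * ((q : ℝ) ^ c.l * q ^ c.b) := by
    intro b u
    have h3 := hrel.errorProbOf_le (isDelayed_attack L g h b f hd)
      (hasPower_attack L g h b f hn h1 h2 c) u
    have hcard : (0 : ℝ) < Fintype.card ((Fin c.l → Fin q) × (Fin c.b → Fin q)) := by
      simp only [Fintype.card_prod, Fintype.card_fun, Fintype.card_fin]
      exact_mod_cast Nat.mul_pos (Nat.pow_pos (by omega)) (Nat.pow_pos (by omega))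
    rw [errorProbOf, div_le_iff₀ hcard] at h3
    simp only [Fintype.card_prod, Fintype.card_fun, Fintype.card_fin, Nat.cast_mul,
      Nat.cast_pow] at h3
    refine le_trans (le_of_eq ?_) h3
    rw [Finset.card_filter, ← Finset.univ_product_univ, Finset.sum_product]
    push_cast
    refine Finset.sum_congr rfl fun r _ => ?_
    simp only [wr]
    rw [Finset.card_filter]
    push_cast
    rfl
  have hup : ∑ z, N z (f (pre L (X z))) ≤ (q : ℝ) ^ c.k * (1 / 4 * ((q : ℝ) ^ c.l * q ^ c.b)) := by
    have h3 : ∑ z, N z (f (pre L (X z))) = ∑ u, (∑ r, wr (received (attack L g h true f)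
        (c.enc u r)) u + ∑ r, wr (received (attack L g h false f) (c.enc u r)) u) := by
      rw [← Finset.univ_product_univ, Finset.sum_product]
      refine Finset.sum_congr rfl fun u _ => ?_
      rw [← Finset.sum_add_distrib]
      refine Finset.sum_congr rfl fun r _ => ?_
      rw [received_attack_true, received_attack_false _ _ _ _ _ (hfX (u, r))]
    rw [h3]
    calc _ ≤ ∑ u : Fin c.k → Fin q, 1 / 4 * ((q : ℝ) ^ c.l * q ^ c.b) :=
          Finset.sum_le_sum fun u _ => by linarith [herr true u, herr false u]
      _ = _ := by simp
  have hq2 : (2 : ℝ) ≤ q := by exact_mod_cast hq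
  have hkL : (2 : ℝ) * q ^ L ≤ q ^ c.k := by
    calc (2 : ℝ) * q ^ L ≤ q * q ^ L := by gcongr
      _ = (q : ℝ) ^ (L + 1) := by ring
      _ ≤ _ := pow_le_pow_right₀ (by linarith) hk
  have h9 := hlow.trans hup
  have hl : (0 : ℝ) < (q : ℝ) ^ c.l * q ^ c.b := by positivity
  have hkpos : (0 : ℝ) < (q : ℝ) ^ c.k := by positivity
  have h10 : ((q : ℝ) ^ c.k - q ^ L) * ((q : ℝ) ^ c.l * q ^ c.b) ≤
      (1 / 4 * (q : ℝ) ^ c.k) * ((q : ℝ) ^ c.l * q ^ c.b) := by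
    rw [pow_add] at h9
    linarith
  have h11 := le_of_mul_le_mul_right h10 hl
  linarith

end Converse

/-! ### Upper bounds on the rate -/

theorem Achievable.exists_reliable {p d R : ℝ} (h : Achievable p d R) {δ : ℝ} (hδ : 0 < δ) :
    ∃ N : ℕ, ∀ n : ℕ, N ≤ n → ∃ q : ℕ, 2 ≤ q ∧ ∃ c : Code n q, (R - δ) * n ≤ c.k ∧
      c.Reliable p d (1 / 8) := by
  obtain ⟨N, hN⟩ := h (1 / 8) (by norm_num) δ hδ
  refine ⟨N, fun n hn => ?_⟩
  obtain ⟨q, hq, c, hc⟩ := hN n hn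
  exact ⟨q, hq.two_le, c, hc⟩

/-- The last `⌊p * n⌋₊` symbols are erased and nothing is left to imitate, so no delay condition
arises. -/
theorem Achievable.le_one_sub {p d R : ℝ} (hp0 : 0 ≤ p) (hp1 : p ≤ 1) (h : Achievable p d R) :
    R ≤ 1 - p := by
  by_contra! hR
  obtain ⟨δ, hδ, hRδ⟩ : ∃ δ : ℝ, 0 < δ ∧ R - δ = 1 - p + δ :=
    ⟨(R - (1 - p)) / 2, by linarith, by ring⟩
  obtain ⟨N, hN⟩ := h.exists_reliable hδ
  obtain ⟨M, hM⟩ := exists_nat_gt (2 / δ)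
  set n := max N M
  have hn : 2 ≤ δ * n := by
    have h1 : (M : ℝ) ≤ n := by exact_mod_cast le_max_right N M
    rw [div_lt_iff₀ hδ] at hM
    nlinarith
  obtain ⟨q, hq, c, hk, hc⟩ := hN n (le_max_left _ _)
  have : NeZero q := ⟨by omega⟩
  have hf : (⌊p * n⌋₊ : ℝ) ≤ p * n := Nat.floor_le (by positivity)
  have hf' : p * n < ⌊p * n⌋₊ + 1 := Nat.lt_floor_add_one _
  have hfn : ⌊p * n⌋₊ ≤ n := by
    have h2 : p * n ≤ n := by nlinarith [Nat.cast_nonneg (α := ℝ) n]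
    exact_mod_cast hf.trans h2
  refine not_reliable (n - ⌊p * n⌋₊) ⌊p * n⌋₊ 0 (h' := 0) hq c (by omega) (by simpa using hf)
    (by simpa using hf) (fun i j hi hin _ => by omega) ?_ hc
  have : ((n - ⌊p * n⌋₊ : ℕ) : ℝ) + 1 ≤ c.k := by
    rw [Nat.cast_sub hfn]
    rw [hRδ] at hk
    nlinarith
  exact_mod_cast this

theorem Achievable.le_of_delay {p d R : ℝ} (hd : 0 < d) (hdp : d < p) (hp : p < 1 / 2)
    (h : Achievable p d R) : R ≤ 1 - 2 * p + d := by
  by_contra! hR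
  obtain ⟨δ, hδ, hRδ⟩ : ∃ δ : ℝ, 0 < δ ∧ R - δ = 1 - 2 * p + d + δ :=
    ⟨(R - (1 - 2 * p + d)) / 2, by linarith, by ring⟩
  obtain ⟨N, hN⟩ := h.exists_reliable hδ
  obtain ⟨M, hM⟩ := exists_nat_gt (5 / min δ (2 * (p - d)))
  have hmin : 0 < min δ (2 * (p - d)) := lt_min hδ (by linarith)
  set n := max N M
  have hn : 5 ≤ min δ (2 * (p - d)) * n := by
    have h1 : (M : ℝ) ≤ n := by exact_mod_cast le_max_right N M
    rw [div_lt_iff₀ hmin] at hM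
    nlinarith
  have hn0 : (0 : ℝ) ≤ n := Nat.cast_nonneg n
  have hn1 : 5 ≤ δ * n := hn.trans (by gcongr; exact min_le_left _ _)
  have hn2 : 5 ≤ 2 * (p - d) * n := hn.trans (by gcongr; exact min_le_right _ _)
  obtain ⟨q, hq, c, hk, hc⟩ := hN n (le_max_left _ _)
  have : NeZero q := ⟨by omega⟩
  have ha0 : 0 ≤ (1 - 2 * p + d) * n := mul_nonneg (by linarith) hn0
  have hb0 : 0 ≤ d * n := mul_nonneg hd.le hn0
  set a := ⌈(1 - 2 * p + d) * n⌉₊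
  set g := ⌈d * n⌉₊
  have ha1 : (1 - 2 * p + d) * n ≤ a := Nat.le_ceil _
  have ha2 : (a : ℝ) < (1 - 2 * p + d) * n + 1 := Nat.ceil_lt_add_one ha0
  have hg1 : d * n ≤ g := Nat.le_ceil _
  have hg2 : (g : ℝ) < d * n + 1 := Nat.ceil_lt_add_one hb0
  have hle : a + 3 + g ≤ n := by
    have : (a : ℝ) + 3 + g ≤ n := by nlinarith
    exact_mod_cast this
  -- The remainder is halved. The `3` added to `a` pays for rounding up `d * n` and for an odd
  -- remainder, so that `g + h2` still fits into the power.
  obtain ⟨h1, h2, hh, hh1, hh2⟩ : ∃ h1 h2 : ℕ, a + 3 + g + h1 + h2 = n ∧ h1 ≤ h2 ∧ h2 ≤ h1 + 1 :=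
    ⟨(n - (a + 3 + g)) / 2, n - (a + 3 + g) - (n - (a + 3 + g)) / 2, by omega, by omega, by omega⟩
  have hhr : (a : ℝ) + 3 + g + h1 + h2 = n := by exact_mod_cast hh
  have hh1r : (h1 : ℝ) ≤ h2 := by exact_mod_cast hh1
  have hh2r : (h2 : ℝ) ≤ h1 + 1 := by exact_mod_cast hh2
  refine not_reliable (a + 3) g h1 (h' := h2) hq c hh (by push_cast; nlinarith)
    (by push_cast; nlinarith) (fun i j hi _ hj => ?_) ?_ hc
  · have h5 : j + g ≤ i := by omega
    have h6 : (j : ℝ) + g ≤ i := by exact_mod_cast h5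
    linarith
  · have : (a : ℝ) + 3 + 1 ≤ c.k := by
      rw [hRδ] at hk
      nlinarith
    exact_mod_cast this

/-- An even block length splits into two halves, each within the power. With an empty prefix the
jammer needs to see nothing. -/
theorem Achievable.le_zero {p d R : ℝ} (hp : 1 / 2 ≤ p) (h : Achievable p d R) : R ≤ 0 := by
  by_contra! hR
  obtain ⟨N, hN⟩ := h.exists_reliable (half_pos hR)
  obtain ⟨q, hq, c, hk, hc⟩ := hN (2 * (N + 1)) (by omega)
  have : NeZero q := ⟨by omega⟩
  have hM : ((0 + (N + 1) : ℕ) : ℝ) ≤ p * (2 * (N + 1) : ℕ) := by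
    push_cast
    nlinarith [Nat.cast_nonneg (α := ℝ) N]
  refine not_reliable 0 0 (N + 1) (h' := N + 1) hq c (by omega) hM hM (fun i j _ _ hj => by omega)
    ?_ hc
  have : (0 : ℝ) < c.k := lt_of_lt_of_le (mul_pos (by linarith) (by positivity)) hk
  exact_mod_cast this

theorem EfficientlyAchievable.achievable {p d R : ℝ} (h : EfficientlyAchievable p d R) :
    Achievable p d R := by
  intro ε hε δ hδ
  obtain ⟨E, D, a, N, hN⟩ := h ε hε δ hδ
  refine ⟨N, fun n hn => ?_⟩
  obtain ⟨q, hq, -, -, c, hk, hc, -⟩ := hN n hn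
  exact ⟨q, hq, c, hk, hc⟩

theorem EfficientlyAchievable.isCapacity {p d C : ℝ} (h : EfficientlyAchievable p d C)
    (hC : 0 ≤ C) (hub : ∀ R, Achievable p d R → R ≤ C) : IsCapacity p d C :=
  IsGreatest.isLUB ⟨⟨hC, h.achievable⟩, fun R hR => hub R hR.2⟩

/-- Codes without messages. -/
theorem efficientlyAchievable_zero (p d : ℝ) : EfficientlyAchievable p d 0 := by
  intro ε hε δ hδ
  -- The encoder outputs the zero word: it has to clear only cell `0`, which holds the block length.
  -- The decoder has nothing to output.
  refine ⟨.store (.lit 0) (.lit 0), .skip, 10, 2, fun n hn => ⟨2 ^ n, ?_, le_rfl, ?_, ?_⟩⟩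
  · exact (isPrimePow_nat_iff _).2 ⟨2, n, Nat.prime_two, by omega, rfl⟩
  · exact Nat.pow_le_pow_right (by norm_num) (Nat.le_self_pow (by norm_num) n)
  · have h0 : 0 < 2 ^ n := Nat.two_pow_pos n
    have hT : 10 ≤ n ^ 10 := le_trans (by norm_num) (Nat.pow_le_pow_left hn 10)
    refine ⟨⟨0, 0, 0, fun _ _ _ => ⟨0, h0⟩, fun _ _ i => i.elim0⟩, ?_, ?_, Nat.zero_le _,
      Nat.zero_le _, fun u r => ?_, fun y s => ?_⟩
    · have : 0 ≤ δ * n := by positivity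
      simp
      linarith
    · refine Code.reliable_of_forall fun J _ _ u => ?_
      refine le_trans (le_of_eq ?_) hε.le
      rw [errorProbOf, Finset.filter_false_of_mem, Finset.card_empty, Nat.cast_zero, zero_div]
      intro z _
      simp only [ne_eq, not_not]
      exact Subsingleton.elim _ _
    · refine ⟨_, _, Exec.store _ _ _, ?_, fun i hi => ?_⟩
      · refine le_trans ?_ hT
        have := size_le_self 0
        simp only [Expr.cost, Expr.eval]
        omega
      · simp only [word, List.length_ofFn] at hi
        by_cases hi0 : i = 0
        · subst hi0
          simp [word, Expr.eval, hi]
        · simp only [Expr.eval]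
          rw [Function.update_of_ne hi0]
          simp only [word, List.getD_eq_getElem?_getD]
          obtain ⟨i, rfl⟩ := Nat.exists_eq_succ_of_ne_zero hi0
          simp [hi]
    · refine ⟨_, _, Exec.skip _, by omega, fun i hi => ?_⟩
      simp [word] at hi

/-! ### Residues -/

/-- Moduli as in Gödel's beta function: a common prime divides `(j - i) * V`, hence `V` because `j -
i` divides `F!`, hence one. -/
theorem coprime_one_add_mul {F V i j : ℕ} (hV : F.factorial ∣ V) (hij : i < j) (hj : j < F) :
    Nat.Coprime (1 + (i + 1) * V) (1 + (j + 1) * V) := by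
  refine Nat.Coprime.symm (Nat.coprime_of_dvd fun p hp h1 h2 => ?_)
  have h3 : p ∣ (j - i) * V := by
    have := (Nat.dvd_sub h1 h2)
    rwa [show 1 + (j + 1) * V - (1 + (i + 1) * V) = (j - i) * V by
      rw [Nat.add_sub_add_left, ← Nat.sub_mul, Nat.add_sub_add_right]] at this
  have h4 : p ∣ V := by
    rcases (Nat.Prime.dvd_mul hp).1 h3 with h | h
    · exact (h.trans (Nat.dvd_factorial (by omega) (by omega))).trans hV
    · exact h
  have h5 : p ∣ 1 := (Nat.dvd_add_left (h4.mul_left (i + 1))).1 h2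
  exact hp.one_lt.ne' (Nat.dvd_one.1 h5)

theorem pairwise_coprime_one_add_mul {F V : ℕ} (hV : F.factorial ∣ V) {s : Finset ℕ}
    (hs : ∀ i ∈ s, i < F) :
    (s : Set ℕ).Pairwise (Function.onFun Nat.Coprime fun i => 1 + (i + 1) * V) := by
  intro i hi j hj hij
  rcases lt_or_gt_of_ne hij with h | h
  · exact coprime_one_add_mul hV h (hs j hj)
  · exact (coprime_one_add_mul hV h (hs i hi)).symm

theorem modEq_prod {s : Finset ℕ} {r : ℕ → ℕ}
    (hr : (s : Set ℕ).Pairwise (Function.onFun Nat.Coprime r)) {a b : ℕ}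
    (h : ∀ i ∈ s, a ≡ b [MOD r i]) : a ≡ b [MOD ∏ i ∈ s, r i] := by
  rw [Nat.modEq_iff_dvd]
  push_cast
  refine Finset.prod_dvd_of_coprime (fun i hi j hj hij => ?_) fun i hi =>
    (Nat.modEq_iff_dvd.1 (h i hi))
  exact Nat.isCoprime_iff_coprime.2 (hr hi hj hij)

/-- Two numbers below `b ^ t` with the same residues for `t` coprime moduli, all at least `b`,
are equal. -/
theorem eq_of_modEq {s : Finset ℕ} {r : ℕ → ℕ}
    (hr : (s : Set ℕ).Pairwise (Function.onFun Nat.Coprime r)) {a a' b t : ℕ} (hb : 0 < b)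
    (hbr : ∀ i ∈ s, b ≤ r i) (ht : t ≤ s.card) (h : ∀ i ∈ s, a ≡ a' [MOD r i])
    (ha : a < b ^ t) (ha' : a' < b ^ t) : a = a' := by
  have h1 : b ^ t ≤ ∏ i ∈ s, r i := by
    calc b ^ t ≤ b ^ s.card := Nat.pow_le_pow_right hb ht
      _ = ∏ _i ∈ s, b := by simp
      _ ≤ _ := Finset.prod_le_prod' hbr
  exact Nat.ModEq.eq_of_lt_of_lt (modEq_prod hr h) (ha.trans_le h1) (ha'.trans_le h1)

/-- An explicit inverse, which spares the programs the Euclidean algorithm. Modulo `1 + (i + 1) * W`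
one has `(i + 1) * (1 + (j + 1) * W) ≡ i - j`, and multiplying by `(i + 1) * (W / |i - j|)` gives `±
(i + 1) * W ≡ ∓ 1`. The square removes the sign. -/
theorem sq_modEq_one {W F i j : ℕ} (hW : F.factorial ∣ W) (hij : i ≠ j) (hi : i < F) (hj : j < F) :
    ((1 + (j + 1) * W) * (i + 1) ^ 2 * (W / ((i - j) + (j - i)))) ^ 2 ≡ 1 [MOD 1 + (i + 1) * W] := by
  set a := (i - j) + (j - i) with ha
  obtain ⟨b, hb⟩ : a ∣ W := (Nat.dvd_factorial (by omega) (by omega)).trans hW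
  have hb' : W / a = b := by rw [hb]; exact Nat.mul_div_cancel_left _ (by omega)
  rw [hb']
  have hsq : ((i : ℤ) - j) ^ 2 = (a : ℤ) ^ 2 := by
    rcases le_total i j with h | h
    · have : (a : ℤ) = j - i := by omega
      rw [this]; ring
    · have : (a : ℤ) = i - j := by omega
      rw [this]
  rw [Nat.modEq_iff_dvd]
  push_cast
  have hbz : (W : ℤ) = a * b := by exact_mod_cast hb
  have e1 : ((i : ℤ) + 1) * (1 + (j + 1) * W) = (i - j) + (j + 1) * (1 + (i + 1) * W) := by ring
  have e2 : ((1 + ((j : ℤ) + 1) * W) * ((i : ℤ) + 1) ^ 2 * b) ^ 2 =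
      (((i : ℤ) + 1) * (1 + (j + 1) * W)) ^ 2 * ((i + 1) * b) ^ 2 := by ring
  have e3 : ((a : ℤ) * ((i + 1) * b)) = (1 + (i + 1) * W) - 1 := by rw [hbz]; ring
  rw [e2, e1]
  set m : ℤ := 1 + (i + 1) * W with hm
  have e4 : ((i : ℤ) - j + (j + 1) * m) ^ 2 * ((i + 1) * b) ^ 2 =
      ((i : ℤ) - j) ^ 2 * ((i + 1) * b) ^ 2 +
        m * ((2 * (i - j) * (j + 1) + (j + 1) ^ 2 * m) * ((i + 1) * b) ^ 2) := by ring
  have e5 : ((i : ℤ) - j) ^ 2 * ((i + 1) * b) ^ 2 = (m - 1) ^ 2 := by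
    rw [hsq, ← mul_pow, e3]
  rw [e4, e5]
  exact ⟨2 - m - ((2 * (i - j) * (j + 1) + (j + 1) ^ 2 * m) * ((i + 1) * b) ^ 2), by ring⟩

theorem sum_digits_lt {H : ℕ} {t : ℕ → ℕ} {n : ℕ} (ht : ∀ j < n, t j < H) :
    ∑ j ∈ Finset.range n, t j * H ^ j < H ^ n := by
  induction n with
  | zero => simp
  | succ n ih =>
    rw [Finset.sum_range_succ, pow_succ]
    have h1 := ih fun j hj => ht j (by omega)
    have h2 := ht n (by omega)
    calc _ < H ^ n + t n * H ^ n := by omega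
      _ = (t n + 1) * H ^ n := by ring
      _ ≤ H * H ^ n := Nat.mul_le_mul_right _ h2
      _ = _ := mul_comm _ _

theorem sum_digits_div_mod {H : ℕ} {t : ℕ → ℕ} {n i : ℕ} (ht : ∀ j < n, t j < H) (hi : i < n) :
    (∑ j ∈ Finset.range n, t j * H ^ j) / H ^ i % H = t i := by
  have hH : 0 < H := (Nat.zero_le _).trans_lt (ht i hi)
  obtain ⟨m, rfl⟩ : ∃ m, n = i + (m + 1) := ⟨n - i - 1, by omega⟩
  have hlow : ∑ j ∈ Finset.range i, t j * H ^ j < H ^ i :=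
    sum_digits_lt fun j hj => ht j (by omega)
  rw [Finset.sum_range_add, Finset.sum_range_succ']
  have : ∑ k ∈ Finset.range m, t (i + (k + 1)) * H ^ (i + (k + 1)) =
      H ^ i * (H * ∑ k ∈ Finset.range m, t (i + (k + 1)) * H ^ k) := by
    rw [Finset.mul_sum, Finset.mul_sum]
    exact Finset.sum_congr rfl fun k _ => by ring
  rw [this, add_zero, mul_comm (t i), ← Nat.mul_add, Nat.add_mul_div_left _ _ (by positivity),
    Nat.div_eq_of_lt hlow, zero_add, Nat.mul_add_mod, Nat.mod_eq_of_lt (ht i hi)]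

/-! ### Two large consistent sets -/

/-- Let `jm` be the last element of `S ∩ T`, which is nonempty as `2 * P < Z`. Up to the distance `D
n / Z` beyond `jm` the sets `E` and `E'` coincide, so `E ∩ E'` contains all of `S ∪ T` there. Now `S
∪ T` has at least `2 (1 - P / Z) n - (jm + 1)` elements, of which at most `n - jm - D n / Z` lie
farther out; `jm` cancels in the difference. -/
theorem card_inter_ge {n Z P D : ℕ} (hD : 0 < D) (hn : 0 < n) (hDP : D ≤ P) (hPZ : 2 * P < Z)
    {S T E E' : Finset ℕ} (hE : E ⊆ Finset.range n) (hE' : E' ⊆ Finset.range n)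
    (hT : T ⊆ E) (hS : S ⊆ E') (hTc : Z * n ≤ Z * T.card + P * n)
    (hSc : Z * n ≤ Z * S.card + P * n)
    (h : ∀ j ∈ S ∩ T, ∀ i < n, Z * i < Z * j + D * n → (i ∈ E ↔ i ∈ E')) :
    (Z + D) * n ≤ Z * ((E ∩ E').card + 2) + 2 * P * n := by
  have hTn : T ⊆ Finset.range n := hT.trans hE
  have hSn : S ⊆ Finset.range n := hS.trans hE'
  have hU : (S ∪ T).card ≤ n := by
    simpa using Finset.card_le_card (Finset.union_subset hSn hTn)
  have hadd := Finset.card_union_add_card_inter S T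
  have hne : (S ∩ T).Nonempty := by
    rw [← Finset.card_pos]
    by_contra h0
    have h1 : S.card + T.card ≤ n := by omega
    have h2 : Z * (S.card + T.card) ≤ Z * n := Nat.mul_le_mul_left _ h1
    have h3 : 2 * P * n < Z * n := Nat.mul_lt_mul_of_pos_right hPZ hn
    nlinarith
  obtain ⟨jm, hjm, hmax⟩ := Finset.exists_max_image (S ∩ T) id hne
  have hjn : jm < n := Finset.mem_range.1 (hTn (Finset.mem_inter.1 hjm).2)
  -- the positions that `jm` can check
  let I := (Finset.range n).filter fun i => Z * i < Z * jm + D * n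
  have hI : (S ∪ T) ∩ I ⊆ E ∩ E' := by
    intro i hi
    obtain ⟨h1, h2⟩ := Finset.mem_inter.1 hi
    obtain ⟨h3, h4⟩ := Finset.mem_filter.1 h2
    have h5 := h jm hjm i (Finset.mem_range.1 h3) h4
    rcases Finset.mem_union.1 h1 with h6 | h6
    · exact Finset.mem_inter.2 ⟨h5.2 (hS h6), hS h6⟩
    · exact Finset.mem_inter.2 ⟨hT h6, h5.1 (hT h6)⟩
  have hAI : S ∩ T ⊆ I := fun i hi => by
    have h1 : i ≤ jm := hmax i hi
    refine Finset.mem_filter.2 ⟨hTn (Finset.mem_inter.1 hi).2, ?_⟩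
    have h2 : Z * i ≤ Z * jm := Nat.mul_le_mul_left _ h1
    have : 0 < D * n := Nat.mul_pos hD hn
    omega
  have hA : (S ∩ T).card ≤ jm + 1 := by
    have : S ∩ T ⊆ Finset.range (jm + 1) := fun i hi =>
      Finset.mem_range.2 (Nat.lt_succ_of_le (hmax i hi))
    simpa using Finset.card_le_card this
  have hsplit : (S ∪ T).card ≤ (E ∩ E').card + (Finset.range n \ I).card := by
    have h1 := Finset.card_inter_add_card_sdiff (S ∪ T) I
    have h2 := Finset.card_le_card hI
    have h3 : ((S ∪ T) \ I).card ≤ (Finset.range n \ I).card :=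
      Finset.card_le_card (Finset.sdiff_subset_sdiff (Finset.union_subset hSn hTn) le_rfl)
    omega
  -- If `jm` checks every position, the estimate of the far part fails, but then all of `T` is
  -- common, which is enough since `D ≤ P`.
  by_cases hfull : Finset.range n \ I = ∅
  · have h1 : T ⊆ E ∩ E' := fun i hi => hI (Finset.mem_inter.2 ⟨Finset.mem_union_right _ hi, by
      by_contra h2
      have : i ∈ Finset.range n \ I := Finset.mem_sdiff.2 ⟨hTn hi, h2⟩
      rw [hfull] at this
      exact absurd this (Finset.notMem_empty _)⟩)
    have h2 : Z * T.card ≤ Z * (E ∩ E').card := Nat.mul_le_mul_left _ (Finset.card_le_card h1)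
    have h3 : D * n ≤ P * n := Nat.mul_le_mul_right _ hDP
    nlinarith
  · -- the remaining positions start after a gap
    have h1 : Z * (Finset.range n \ I).card + (Z * jm + D * n) ≤ Z * n := by
      obtain ⟨i0, hi0⟩ := Finset.nonempty_iff_ne_empty.2 hfull
      obtain ⟨m, hm, hmin⟩ := Finset.exists_min_image (Finset.range n \ I) id ⟨i0, hi0⟩
      have hm1 := Finset.mem_sdiff.1 hm
      have hm2 : Z * jm + D * n ≤ Z * m := by
        by_contra hcon
        exact hm1.2 (Finset.mem_filter.2 ⟨hm1.1, by omega⟩)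
      have hm3 : (Finset.range n \ I).card ≤ n - m := by
        have : Finset.range n \ I ⊆ Finset.Ico m n := fun i hi => Finset.mem_Ico.2
          ⟨hmin i hi, Finset.mem_range.1 (Finset.mem_sdiff.1 hi).1⟩
        simpa using Finset.card_le_card this
      have hm4 : m < n := Finset.mem_range.1 hm1.1
      have hm5 : (Finset.range n \ I).card + m ≤ n := by omega
      have := Nat.mul_le_mul_left Z hm5
      rw [Nat.mul_add] at this
      omega
    have h2 : S.card + T.card ≤ (E ∩ E').card + (Finset.range n \ I).card + (jm + 1) := by omega
    have h3 := Nat.mul_le_mul_left Z h2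
    simp only [Nat.mul_add] at h3 ⊢
    nlinarith

/-! ### The code -/

/-- The number of keys. -/
def keys (n : ℕ) : ℕ := n ^ 5
/-- The unit in which sizes are measured. -/
def base (n : ℕ) : ℕ := 2 ^ keys n ^ 2
/-- The modulus that belongs to the key `κ`. -/
def tagMod (n κ : ℕ) : ℕ := 1 + (κ + 1) * ((keys n).factorial * base n)
def tagBound (n : ℕ) : ℕ := base n ^ 3
-- Room for a key (one factor `base n`), for `n` tags (three factors each) and for the two factors
-- by which `resBound` exceeds `block n ^ n`. So a symbol consists of `n` blocks of information and
-- one of overhead.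
def block (n : ℕ) : ℕ := base n ^ (3 * (n + 1))
/-- The size of the alphabet. -/
def alph (n : ℕ) : ℕ := block n ^ (n + 1)
def resStep (n : ℕ) : ℕ := (keys n).factorial * block n ^ n
/-- The modulus that belongs to the position `i`. -/
def resMod (n i : ℕ) : ℕ := 1 + (i + 1) * resStep n
def resBound (n : ℕ) : ℕ := base n ^ 2 * block n ^ n
/-- The length of the messages. -/
def msgLen (Z P D n : ℕ) : ℕ := n * (Z + D - 2 * P) / Z - 3

/-- The symbol at position `i` for the message number `U` and the key `κ`: the residue of `U`, the
key and the tags of the residues of all positions. -/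
def symbol (n U κ i : ℕ) : ℕ :=
  U % resMod n i + resBound n * (κ + keys n *
    ∑ j ∈ Finset.range n, U % resMod n j % tagMod n κ * tagBound n ^ j)

def symRes (n s : ℕ) : ℕ := s % resBound n
def symKey (n s : ℕ) : ℕ := s / resBound n % keys n
def symTag (n s j : ℕ) : ℕ := s / resBound n / keys n / tagBound n ^ j % tagBound n

/-- The symbol at `j` carries the correct tag of the residue at `i`. -/
def Accepts (n : ℕ) (y : ℕ → ℕ) (j i : ℕ) : Prop :=
  symRes n (y i) % tagMod n (symKey n (y j)) = symTag n (y j) i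

instance (n : ℕ) (y : ℕ → ℕ) (j i : ℕ) : Decidable (Accepts n y j i) :=
  inferInstanceAs (Decidable (_ = _))

/-- The symbol at `j` is not known when the one at `i` is jammed. -/
def Near (Z D n j i : ℕ) : Prop := Z * i < Z * j + D * n

instance (Z D n j i : ℕ) : Decidable (Near Z D n j i) := inferInstanceAs (Decidable (_ < _))

/-- A multiple of the `j`-th modulus that is one modulo the `i`-th. -/
def idem (n i j : ℕ) : ℕ :=
  ((1 + (j + 1) * resStep n) * (i + 1) ^ 2 * (resStep n / ((i - j) + (j - i)))) ^ 2

/-- The number with the residues of all positions that the symbol at `g` accepts. -/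
def cand (Z D n : ℕ) (y : ℕ → ℕ) (g : ℕ) : ℕ :=
  (∑ i ∈ Finset.range n, if Near Z D n g i ∧ Accepts n y g i then symRes n (y i) *
      ∏ j ∈ Finset.range n,
        (if (Near Z D n g j ∧ Accepts n y g j) ∧ ¬ j = i then idem n i j else 1) else 0) %
    ∏ i ∈ Finset.range n, if Near Z D n g i ∧ Accepts n y g i then resMod n i else 1

/-- The residue at `i` is that of `U`. -/
def Agrees (n : ℕ) (y : ℕ → ℕ) (U i : ℕ) : Prop := symRes n (y i) = U % resMod n i

instance (n : ℕ) (y : ℕ → ℕ) (U i : ℕ) : Decidable (Agrees n y U i) :=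
  inferInstanceAs (Decidable (_ = _))

/-- Position `j` agrees with `U` and confirms the residues of `U` near `j` and no others. -/
def Supports (Z D n : ℕ) (y : ℕ → ℕ) (U j : ℕ) : Prop :=
  Agrees n y U j ∧ ∀ i < n, ((Near Z D n j i ∧ Accepts n y j i) ↔ (Near Z D n j i ∧ Agrees n y U i))

instance (Z D n : ℕ) (y : ℕ → ℕ) (U j : ℕ) : Decidable (Supports Z D n y U j) :=
  inferInstanceAs (Decidable (_ ∧ _))

/-- `U` is a message number with enough support. -/
def Valid (Z P D n : ℕ) (y : ℕ → ℕ) (U : ℕ) : Prop :=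
  U < alph n ^ msgLen Z P D n ∧
    Z * n < Z * (∑ j ∈ Finset.range n, if Supports Z D n y U j then 1 else 0) + P * n + 1

instance (Z P D n : ℕ) (y : ℕ → ℕ) (U : ℕ) : Decidable (Valid Z P D n y U) :=
  inferInstanceAs (Decidable (_ ∧ _))

/-- The decoder: the common value of the valid candidates. -/
def decode (Z P D n : ℕ) (y : ℕ → ℕ) : ℕ :=
  (∑ g ∈ Finset.range n, if Valid Z P D n y (cand Z D n y g) then cand Z D n y g else 0) /
    ∑ g ∈ Finset.range n, if Valid Z P D n y (cand Z D n y g) then 1 else 0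

/-! ### Sizes -/

theorem keys_pos {n : ℕ} (hn : 0 < n) : 0 < keys n := Nat.pow_pos hn

theorem le_keys (n : ℕ) : n ≤ keys n := Nat.le_self_pow (by norm_num) n

theorem base_pos (n : ℕ) : 0 < base n := Nat.two_pow_pos _

theorem block_pos (n : ℕ) : 0 < block n := Nat.pow_pos (base_pos n)

theorem factorial_keys_le (n : ℕ) : (keys n).factorial ≤ base n := by
  calc (keys n).factorial ≤ keys n ^ keys n := Nat.factorial_le_pow _
    _ ≤ (2 ^ keys n) ^ keys n := Nat.pow_le_pow_left Nat.lt_two_pow_self.le _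
    _ = base n := by rw [base, ← pow_mul, sq]

theorem keys_lt_base (n : ℕ) : keys n < base n :=
  (Nat.lt_two_pow_self (n := keys n)).trans_le
    (Nat.pow_le_pow_right (by norm_num) (Nat.le_self_pow (by norm_num) _))

theorem tagMod_le {n : ℕ} {κ : ℕ} (hκ : κ < keys n) : tagMod n κ ≤ tagBound n := by
  have h1 := factorial_keys_le n
  have h2 := keys_lt_base n
  have h3 := base_pos n
  calc tagMod n κ ≤ 1 + keys n * (base n * base n) := by
        unfold tagMod
        gcongr
        exact hκ
    _ ≤ (keys n + 1) * (base n * base n) := by nlinarith [Nat.mul_pos h3 h3]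
    _ ≤ base n * (base n * base n) := Nat.mul_le_mul_right _ h2
    _ = tagBound n := by rw [tagBound]; ring

theorem base_le_tagMod (n : ℕ) (κ : ℕ) : base n ≤ tagMod n κ := by
  have h1 := Nat.factorial_pos (keys n)
  unfold tagMod
  nlinarith [Nat.zero_le (κ * ((keys n).factorial * base n)), base_pos n]

theorem resMod_le {n : ℕ} {i : ℕ} (hi : i < n) : resMod n i ≤ resBound n := by
  have h1 := factorial_keys_le n
  have h2 := keys_lt_base n
  have h3 := base_pos n
  have h4 := Nat.pow_pos (n := n) (block_pos n)
  have h5 := le_keys n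
  calc resMod n i ≤ 1 + keys n * (base n * block n ^ n) := by
        unfold resMod resStep
        gcongr
        omega
    _ ≤ (keys n + 1) * (base n * block n ^ n) := by nlinarith [Nat.mul_pos h3 h4]
    _ ≤ base n * (base n * block n ^ n) := Nat.mul_le_mul_right _ h2
    _ = resBound n := by rw [resBound]; ring

theorem block_pow_le_resMod (n : ℕ) (i : ℕ) : block n ^ n ≤ resMod n i := by
  have h1 := Nat.factorial_pos (keys n)
  have h4 := Nat.pow_pos (n := n) (block_pos n)
  unfold resMod resStep
  nlinarith [Nat.zero_le (i * ((keys n).factorial * block n ^ n))]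

theorem resMod_pos (n : ℕ) (i : ℕ) : 0 < resMod n i := by unfold resMod; omega

theorem resBound_pos (n : ℕ) : 0 < resBound n :=
  Nat.mul_pos (Nat.pow_pos (base_pos n)) (Nat.pow_pos (block_pos n))

theorem tagMod_pos (n : ℕ) (κ : ℕ) : 0 < tagMod n κ := by unfold tagMod; omega

/-- Since `(n + 1) * k ≤ n * (k + 1)`, the overhead in all symbols together costs no more than one
additional residue. -/
theorem alph_pow_le {n : ℕ} {k : ℕ} (hk : k ≤ n) : alph n ^ k ≤ (block n ^ n) ^ (k + 1) := by
  rw [alph, ← pow_mul, ← pow_mul]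
  exact Nat.pow_le_pow_right (block_pos n) (by nlinarith)

theorem tags_lt {n : ℕ} (U : ℕ) {κ : ℕ} (hκ : κ < keys n) :
    ∑ j ∈ Finset.range n, U % resMod n j % tagMod n κ * tagBound n ^ j < tagBound n ^ n :=
  sum_digits_lt fun _ _ => (Nat.mod_lt _ (tagMod_pos n κ)).trans_le (tagMod_le hκ)

theorem mod_resMod_lt {n : ℕ} (U : ℕ) {i : ℕ} (hi : i < n) : U % resMod n i < resBound n :=
  (Nat.mod_lt _ (resMod_pos n i)).trans_le (resMod_le hi)

theorem symbol_lt {n : ℕ} (U : ℕ) {κ i : ℕ} (hκ : κ < keys n) (hi : i < n) :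
    symbol n U κ i < alph n := by
  have h1 := mod_resMod_lt U hi
  have h2 := tags_lt U hκ
  unfold symbol
  generalize (∑ j ∈ Finset.range n, U % resMod n j % tagMod n κ * tagBound n ^ j) = t at h2 ⊢
  calc _ < resBound n * (κ + keys n * t + 1) := by rw [Nat.mul_add_one]; omega
    _ ≤ resBound n * (keys n * (t + 1)) := Nat.mul_le_mul_left _ (by rw [Nat.mul_add_one]; omega)
    _ ≤ resBound n * (base n * tagBound n ^ n) :=
        Nat.mul_le_mul_left _ (Nat.mul_le_mul (keys_lt_base n).le h2)
    _ = alph n := by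
        rw [resBound, alph, tagBound, pow_succ, block]
        ring

theorem symRes_symbol {n : ℕ} (U κ : ℕ) {i : ℕ} (hi : i < n) :
    symRes n (symbol n U κ i) = U % resMod n i := by
  rw [symRes, symbol, Nat.add_mul_mod_self_left, Nat.mod_eq_of_lt (mod_resMod_lt U hi)]

theorem symbol_div {n : ℕ} (U κ : ℕ) {i : ℕ} (hi : i < n) : symbol n U κ i / resBound n = κ + keys n *
    ∑ j ∈ Finset.range n, U % resMod n j % tagMod n κ * tagBound n ^ j := by
  rw [symbol, Nat.add_mul_div_left _ _ (resBound_pos n), Nat.div_eq_of_lt (mod_resMod_lt U hi),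
    zero_add]

theorem symKey_symbol {n : ℕ} (U : ℕ) {κ i : ℕ} (hκ : κ < keys n) (hi : i < n) :
    symKey n (symbol n U κ i) = κ := by
  rw [symKey, symbol_div U κ hi, Nat.add_mul_mod_self_left, Nat.mod_eq_of_lt hκ]

theorem symTag_symbol {n : ℕ} (hn : 0 < n) (U : ℕ) {κ i j : ℕ} (hκ : κ < keys n) (hi : i < n) (hj : j < n) :
    symTag n (symbol n U κ i) j = U % resMod n j % tagMod n κ := by
  rw [symTag, symbol_div U κ hi, Nat.add_mul_div_left _ _ (keys_pos hn), Nat.div_eq_of_lt hκ,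
    zero_add]
  exact sum_digits_div_mod
    (fun _ _ => (Nat.mod_lt _ (tagMod_pos n κ)).trans_le (tagMod_le hκ)) hj

theorem pairwise_coprime_resMod {n : ℕ} {s : Finset ℕ} (hs : s ⊆ Finset.range n) :
    (s : Set ℕ).Pairwise (Function.onFun Nat.Coprime (resMod n)) :=
  pairwise_coprime_one_add_mul (V := resStep n) (Dvd.intro _ rfl) fun _ hi =>
    (Finset.mem_range.1 (hs hi)).trans_le (le_keys n)

/-- Message numbers with the same residues at more than `k` positions are equal. -/
theorem eq_of_resMod {n : ℕ} {s : Finset ℕ} (hs : s ⊆ Finset.range n) {k U U' : ℕ} (hk : k ≤ n)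
    (hU : U < alph n ^ k) (hU' : U' < alph n ^ k) (hc : k + 1 ≤ s.card)
    (h : ∀ i ∈ s, U ≡ U' [MOD resMod n i]) : U = U' :=
  eq_of_modEq (pairwise_coprime_resMod hs) (Nat.pow_pos (block_pos n))
    (fun i _ => block_pow_le_resMod n i) hc h (hU.trans_le (alph_pow_le hk))
    (hU'.trans_le (alph_pow_le hk))

/-- Different residues have the same tag for few keys only. -/
theorem card_keys_le {n : ℕ} {c c' : ℕ} (hc : c < resBound n) (hc' : c' < resBound n) (hne : c ≠ c') :
    ((Finset.range (keys n)).filter fun κ => c % tagMod n κ = c' % tagMod n κ).card ≤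
      3 * n * (n + 1) + 2 := by
  by_contra! hcard
  -- A residue is below `resBound n = base n ^ (3 * n * (n + 1) + 2)`, and each tag modulus is at
  -- least `base n`; that many coincidences would determine it.
  refine hne (eq_of_modEq (r := tagMod n) (b := base n) (t := 3 * n * (n + 1) + 2)
    (pairwise_coprime_one_add_mul (V := (keys n).factorial * base n) (Dvd.intro _ rfl)
      fun i hi => Finset.mem_range.1 (Finset.mem_filter.1 hi).1) (base_pos n)
    (fun i _ => base_le_tagMod n i) hcard.le (fun i hi => (Finset.mem_filter.1 hi).2) ?_ ?_)
  all_goals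
    refine lt_of_lt_of_le (by assumption) (le_of_eq ?_)
    rw [resBound, block]
    ring

/-! ### The decoder -/

/-- Chinese remaindering: modulo `resMod n i` the product belonging to `i` is one by `sq_modEq_one`,
and the product belonging to any other accepted position contains the factor `resMod n i`. -/
theorem cand_modEq {Z D n : ℕ} (y : ℕ → ℕ) {g i : ℕ} (hi : i < n)
    (hs : Near Z D n g i ∧ Accepts n y g i) :
    cand Z D n y g ≡ symRes n (y i) [MOD resMod n i] := by
  have hn : 0 < n := by omega
  have hdvd : resMod n i ∣
      ∏ i ∈ Finset.range n, if Near Z D n g i ∧ Accepts n y g i then resMod n i else 1 := by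
    have := Finset.dvd_prod_of_mem
      (fun i => if Near Z D n g i ∧ Accepts n y g i then resMod n i else 1) (Finset.mem_range.2 hi)
    rwa [if_pos hs] at this
  refine ((Nat.mod_modEq _ _).of_dvd hdvd).trans ?_
  rw [← Finset.add_sum_erase _ _ (Finset.mem_range.2 hi), if_pos hs]
  have h1 : (∏ j ∈ Finset.range n,
      if (Near Z D n g j ∧ Accepts n y g j) ∧ ¬ j = i then idem n i j else 1) ≡ 1
        [MOD resMod n i] := by
    have : (∏ j ∈ Finset.range n, if (Near Z D n g j ∧ Accepts n y g j) ∧ ¬ j = i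
        then idem n i j else 1) ≡ ∏ j ∈ Finset.range n, 1 [MOD resMod n i] := by
      refine Nat.ModEq.prod fun j hj => ?_
      split
      · next h =>
        exact sq_modEq_one (Dvd.intro _ rfl) (Ne.symm h.2) (hi.trans_le (le_keys n))
          ((Finset.mem_range.1 hj).trans_le (le_keys n))
      · exact Nat.ModEq.rfl
    simpa using this
  have h2 : (∑ i' ∈ (Finset.range n).erase i,
      if Near Z D n g i' ∧ Accepts n y g i' then symRes n (y i') * ∏ j ∈ Finset.range n,
        (if (Near Z D n g j ∧ Accepts n y g j) ∧ ¬ j = i' then idem n i' j else 1) else 0) ≡ 0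
        [MOD resMod n i] := by
    refine (Nat.modEq_zero_iff_dvd).2 (Finset.dvd_sum fun i' hi' => ?_)
    split
    · refine Dvd.dvd.mul_left ?_ _
      have := Finset.dvd_prod_of_mem (fun j =>
        if (Near Z D n g j ∧ Accepts n y g j) ∧ ¬ j = i' then idem n i' j else 1)
        (Finset.mem_range.2 hi)
      rw [if_pos ⟨hs, (Finset.ne_of_mem_erase hi').symm⟩] at this
      refine Dvd.dvd.trans ?_ this
      unfold idem resMod
      rw [mul_assoc]
      exact Dvd.dvd.pow (Dvd.intro _ rfl) (by norm_num)
    · exact dvd_zero _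
  simpa using (h1.mul_left (symRes n (y i))).add h2

/-- The deterministic part of the analysis. `T` consists of unchanged positions, and `hgood`
excludes false residues with a correct tag. Then a valid candidate shares more than `msgLen`
residues with `U`, while `U` itself is valid and is the candidate of the last element of `T`. -/
theorem decode_eq {Z P D n U : ℕ} (hD : 0 < D) (hDP : D ≤ P) (hPZ : 2 * P < Z)
    (hlen : 3 ≤ n * (Z + D - 2 * P) / Z) (hU : U < alph n ^ msgLen Z P D n) {y κ : ℕ → ℕ}
    {T : Finset ℕ} (hTn : T ⊆ Finset.range n) (hTc : Z * n ≤ Z * T.card + P * n)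
    (hκ : ∀ j ∈ T, κ j < keys n) (hy : ∀ j ∈ T, y j = symbol n U (κ j) j)
    (hgood : ∀ j ∈ T, ∀ i < n, Near Z D n j i →
      symRes n (y i) % tagMod n (κ j) = U % resMod n i % tagMod n (κ j) →
        symRes n (y i) = U % resMod n i) :
    decode Z P D n y = U := by
  have hn : 0 < n := by
    rcases Nat.eq_zero_or_pos n with rfl | h
    · simp at hlen
    · exact h
  have hZ : 0 < Z := by omega
  have hk : msgLen Z P D n ≤ n := by
    refine (Nat.sub_le _ _).trans ?_
    rw [Nat.div_le_iff_le_mul_add_pred hZ]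
    have : n * (Z + D - 2 * P) ≤ n * Z := Nat.mul_le_mul_left _ (by omega)
    rw [mul_comm Z n]
    omega
  -- an unchanged position confirms the correct residues and no others
  have hacc : ∀ j ∈ T, ∀ i < n, Near Z D n j i → (Accepts n y j i ↔ Agrees n y U i) := by
    intro j hj i hi hji
    have hjn := Finset.mem_range.1 (hTn hj)
    unfold Accepts Agrees
    rw [hy j hj, symKey_symbol U (hκ j hj) hjn, symTag_symbol hn U (hκ j hj) hjn hi]
    exact ⟨hgood j hj i hi hji, fun h => by rw [h]⟩
  have hagr : ∀ j ∈ T, Agrees n y U j := fun j hj => by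
    unfold Agrees
    rw [hy j hj, symRes_symbol U (κ j) (Finset.mem_range.1 (hTn hj))]
  have hsup : ∀ j ∈ T, Supports Z D n y U j := fun j hj =>
    ⟨hagr j hj, fun i hi => and_congr_right fun h => hacc j hj i hi h⟩
  let E : ℕ → Finset ℕ := fun V => (Finset.range n).filter fun i => Agrees n y V i
  let S : ℕ → Finset ℕ := fun V => (Finset.range n).filter fun j => Supports Z D n y V j
  have hSc : ∀ V, (∑ j ∈ Finset.range n, if Supports Z D n y V j then 1 else 0) = (S V).card :=
    fun V => (Finset.card_filter _ _).symm
  have hTE : T ⊆ E U := fun j hj => Finset.mem_filter.2 ⟨hTn hj, hagr j hj⟩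
  -- valid candidates are correct
  have hcount : ∀ c : ℕ, (Z + D) * n ≤ Z * (c + 2) + 2 * P * n → msgLen Z P D n + 1 ≤ c := by
    intro c hc
    have h1 : n * (Z + D - 2 * P) ≤ Z * (c + 2) := by
      rw [Nat.mul_sub, mul_comm n (Z + D), mul_comm n (2 * P)]
      omega
    have h2 : n * (Z + D - 2 * P) / Z ≤ c + 2 := by
      calc _ ≤ Z * (c + 2) / Z := Nat.div_le_div_right h1
        _ = _ := Nat.mul_div_cancel_left _ hZ
    -- The `3` in `msgLen` covers the two positions lost in `card_inter_ge` and the additional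
    -- residue of `alph_pow_le`; by `hlen` the subtraction is not truncated.
    unfold msgLen
    omega
  have huniq : ∀ V, Valid Z P D n y V → V = U := by
    intro V hV
    have hV2 := hV.2
    rw [hSc] at hV2
    have h1 := card_inter_ge (S := S V) (T := T) (E := E U) (E' := E V) hD hn hDP hPZ
      (Finset.filter_subset _ _) (Finset.filter_subset _ _) hTE
      (fun j hj => by
        obtain ⟨h1, h2⟩ := Finset.mem_filter.1 hj
        exact Finset.mem_filter.2 ⟨h1, h2.1⟩) hTc (by omega) (fun j hj i hi hji => by
        obtain ⟨h1, h2⟩ := Finset.mem_inter.1 hj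
        have h3 := (Finset.mem_filter.1 h1).2.2 i hi
        have h4 : Near Z D n j i := hji
        simp only [h4, true_and] at h3
        simp only [E, Finset.mem_filter, Finset.mem_range, hi, true_and]
        rw [← hacc j h2 i hi h4, h3])
    refine eq_of_resMod (s := E U ∩ E V)
      (Finset.inter_subset_left.trans (Finset.filter_subset _ _)) hk hV.1 hU (hcount _ h1)
      fun i hi => ?_
    obtain ⟨h2, h3⟩ := Finset.mem_inter.1 hi
    have h4 : Agrees n y U i := (Finset.mem_filter.1 h2).2
    have h5 : Agrees n y V i := (Finset.mem_filter.1 h3).2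
    exact h5.symm.trans h4
  have hvalid : Valid Z P D n y U := by
    refine ⟨hU, ?_⟩
    rw [hSc]
    have : T.card ≤ (S U).card := Finset.card_le_card fun j hj =>
      Finset.mem_filter.2 ⟨hTn hj, hsup j hj⟩
    have := Nat.mul_le_mul_left Z this
    omega
  -- the last unchanged position gives a correct candidate
  have hTne : T.Nonempty := by
    rw [← Finset.card_pos]
    by_contra h0
    have h1 : T.card = 0 := by omega
    rw [h1] at hTc
    have : P * n < Z * n := Nat.mul_lt_mul_of_pos_right (by omega) hn
    omega
  obtain ⟨g, hg, hmax⟩ := Finset.exists_max_image T id hTne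
  have hgn := Finset.mem_range.1 (hTn hg)
  have hcg : cand Z D n y g = U := by
    have hnear : ∀ i ∈ T, Near Z D n g i := fun i hi => by
      have h1 : Z * i ≤ Z * g := Nat.mul_le_mul_left _ (hmax i hi)
      have : 0 < D * n := Nat.mul_pos hD hn
      unfold Near
      omega
    let s := (Finset.range n).filter fun i => Near Z D n g i ∧ Accepts n y g i
    have hTs : T ⊆ s := fun i hi => Finset.mem_filter.2 ⟨hTn hi, hnear i hi,
      (hacc g hg i (Finset.mem_range.1 (hTn hi)) (hnear i hi)).2 (hagr i hi)⟩
    have hcs : msgLen Z P D n + 1 ≤ s.card := by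
      refine (hcount T.card ?_).trans (Finset.card_le_card hTs)
      have h3 : D * n ≤ P * n := Nat.mul_le_mul_right _ hDP
      nlinarith
    have hmod : ∀ i ∈ s, cand Z D n y g ≡ U [MOD resMod n i] := fun i hi => by
      obtain ⟨h1, h2⟩ := Finset.mem_filter.1 hi
      have hin := Finset.mem_range.1 h1
      refine (cand_modEq y hin h2).trans ?_
      have h3 : Agrees n y U i := (hacc g hg i hin h2.1).1 h2.2
      rw [h3]
      exact Nat.mod_modEq _ _
    have hprod : (∏ i ∈ Finset.range n, if Near Z D n g i ∧ Accepts n y g i then resMod n i else 1) =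
        ∏ i ∈ s, resMod n i := (Finset.prod_filter _ _).symm
    have hlt : cand Z D n y g < ∏ i ∈ s, resMod n i := by
      rw [← hprod]
      exact Nat.mod_lt _ (Finset.prod_pos fun i _ => by
        split
        · exact resMod_pos n i
        · exact one_pos)
    have hUlt : U < ∏ i ∈ s, resMod n i := by
      calc U < (block n ^ n) ^ (msgLen Z P D n + 1) := hU.trans_le (alph_pow_le hk)
        _ ≤ (block n ^ n) ^ s.card := Nat.pow_le_pow_right (Nat.pow_pos (block_pos n)) hcs
        _ = ∏ _i ∈ s, block n ^ n := by simp
        _ ≤ _ := Finset.prod_le_prod' fun i _ => block_pow_le_resMod n i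
    exact Nat.ModEq.eq_of_lt_of_lt
      (modEq_prod (pairwise_coprime_resMod (Finset.filter_subset _ _)) hmod) hlt hUlt
  -- All valid candidates equal `U`, so their average is `U`.
  have hnum : (∑ g ∈ Finset.range n, if Valid Z P D n y (cand Z D n y g) then cand Z D n y g else 0) =
      U * ∑ g ∈ Finset.range n, if Valid Z P D n y (cand Z D n y g) then 1 else 0 := by
    rw [Finset.mul_sum]
    refine Finset.sum_congr rfl fun g _ => ?_
    split
    · next h => rw [huniq _ h, mul_one]
    · simp
  rw [decode, hnum]
  refine Nat.mul_div_cancel _ (Finset.sum_pos' (fun _ _ => Nat.zero_le _)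
    ⟨g, Finset.mem_range.2 hgn, ?_⟩)
  rw [hcg, if_pos hvalid]
  exact one_pos

/-! ### Reliability -/

/-- A word as a sequence of numbers. -/
def ext {m q : ℕ} (x : Fin m → Fin q) (i : ℕ) : ℕ := if h : i < m then (x ⟨i, h⟩ : ℕ) else 0

theorem ext_val {m q : ℕ} (x : Fin m → Fin q) (i : Fin m) : ext x i = x i := by simp [ext]

theorem ext_lt {m q : ℕ} (x : Fin m → Fin q) {i : ℕ} (h : i < m) : ext x i < q := by simp [ext, h]

/-- The number of a message. -/
def number {m q : ℕ} (u : Fin m → Fin q) : ℕ := ∑ i ∈ Finset.range m, ext u i * q ^ i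

theorem alph_pos (n : ℕ) : 0 < alph n := Nat.pow_pos (block_pos n)

/-- The transmitted word. -/
def encode {k n : ℕ} (hn : 0 < n) (u : Fin k → Fin (alph n)) (r : Fin n → Fin (alph n)) :
    Fin n → Fin (alph n) := fun i =>
  ⟨symbol n (number u) (r i % keys n) i, symbol_lt _ (Nat.mod_lt _ (keys_pos hn)) i.2⟩

/-- The code for jammers of power `P / Z` and delay `D / Z`. -/
def code (Z P D : ℕ) {n : ℕ} (hn : 0 < n) : Code n (alph n) where
  k := msgLen Z P D n
  l := n
  b := 0
  enc u r := encode hn u r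
  dec y _ := fun i => ⟨decode Z P D n (ext y) / alph n ^ (i : ℕ) % alph n,
    Nat.mod_lt _ (alph_pos n)⟩

/-- Resampling one coordinate preserves the uniform distribution: exchanging `r j` with an
independent symbol is an involution. So a bound for each choice of the other coordinates is a bound
on the whole. -/
theorem card_filter_update {ι A : Type*} [Fintype ι] [DecidableEq ι] [Fintype A]
    (Q : (ι → A) → Prop) [DecidablePred Q] (j : ι) {m : ℕ}
    (h : ∀ r, (Finset.univ.filter fun a => Q (Function.update r j a)).card ≤ m) :
    Fintype.card A * (Finset.univ.filter Q).card ≤ Fintype.card (ι → A) * m := by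
  classical
  have hinv : Function.Involutive
      (fun x : (ι → A) × A => (Function.update x.1 j x.2, x.1 j)) := fun x => by simp
  have h1 : ∑ x : (ι → A) × A, (if Q (Function.update x.1 j x.2) then 1 else 0) =
      ∑ x : (ι → A) × A, if Q x.1 then 1 else 0 :=
    Equiv.sum_comp hinv.toPerm fun x : (ι → A) × A => if Q x.1 then 1 else 0
  rw [Fintype.sum_prod_type, Fintype.sum_prod_type] at h1
  calc Fintype.card A * (Finset.univ.filter Q).card
      = ∑ r : ι → A, ∑ _a : A, if Q r then 1 else 0 := by
        rw [Finset.card_filter, Finset.mul_sum]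
        exact Finset.sum_congr rfl fun r _ => by simp
    _ = ∑ r : ι → A, ∑ a : A, if Q (Function.update r j a) then 1 else 0 := h1.symm
    _ ≤ ∑ _r : ι → A, m := Finset.sum_le_sum fun r _ => by
        rw [← Finset.card_filter]
        exact h r
    _ = _ := by simp

/-- The key is a uniform symbol reduced modulo the number of keys, hence only almost uniform; the `+
1` accounts for the incomplete last period. -/
theorem card_filter_mod_le {q F : ℕ} (K : Finset ℕ) :
    (Finset.univ.filter fun a : Fin q => (a : ℕ) % F ∈ K).card ≤ K.card * (q / F + 1) := by
  rw [← Finset.card_range (q / F + 1), ← Finset.card_product]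
  refine Finset.card_le_card_of_injOn (fun a : Fin q => ((a : ℕ) % F, (a : ℕ) / F))
    (fun a ha => ?_) fun a _ b _ hab => ?_
  · simp only [Finset.coe_filter, Finset.mem_univ, true_and, Set.mem_ofPred_eq] at ha
    simp only [Finset.coe_product, Set.mem_prod, Finset.mem_coe, Finset.mem_range]
    exact ⟨ha, Nat.lt_succ_of_le (Nat.div_le_div_right a.2.le)⟩
  · simp only [Prod.mk.injEq] at hab
    apply Fin.ext
    rw [← Nat.mod_add_div a F, ← Nat.mod_add_div b F, hab.1, hab.2]

section Reliable

variable {Z P D k n : ℕ} (hn : 0 < n)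

/-- A wrong residue at `i` has the correct tag in the symbol sent at `j`. -/
def Collides (J : Jammer n (alph n)) (u : Fin k → Fin (alph n)) (j i : Fin n)
    (r : Fin n → Fin (alph n)) : Prop :=
  Near Z D n j i ∧
    symRes n (received J (encode hn u r) i) ≠ number u % resMod n i ∧
    symRes n (received J (encode hn u r) i) % tagMod n (r j % keys n) =
      number u % resMod n i % tagMod n (r j % keys n)

instance (J : Jammer n (alph n)) (u : Fin k → Fin (alph n)) (j i : Fin n) :
    DecidablePred (Collides (Z := Z) (D := D) hn J u j i) := fun _ =>
  inferInstanceAs (Decidable (_ ∧ _ ∧ _))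

/-- Since `D / Z ≤ d`, a position that checks `i` is still invisible to the jammer when it acts at
`i`. -/
theorem near_of_le {d : ℝ} (hd : (D : ℝ) ≤ d * Z) {i j j' : ℕ} (h : Near Z D n j i)
    (hj' : (j' : ℝ) ≤ i - d * n) : j' ≠ j := by
  rintro rfl
  unfold Near at h
  have h1 : (Z : ℝ) * i < Z * j' + D * n := by exact_mod_cast h
  have h2 : (Z : ℝ) * j' ≤ Z * (i - d * n) := mul_le_mul_of_nonneg_left hj' (Nat.cast_nonneg _)
  have h3 : (D : ℝ) * n ≤ d * Z * n := mul_le_mul_of_nonneg_right hd (Nat.cast_nonneg _)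
  linarith

/-- With all other keys fixed, the key at `j` influences neither the jammer's action at `i` nor the
residues sent. So the false residue is fixed before this key is drawn, and by `card_keys_le` few
keys hide it. -/
theorem card_collides_le {d : ℝ} (hd : (D : ℝ) ≤ d * Z) {J : Jammer n (alph n)}
    (hJ : IsDelayed d J) (u : Fin k → Fin (alph n)) (j i : Fin n) :
    alph n * (Finset.univ.filter (Collides (Z := Z) (D := D) hn J u j i)).card ≤
      alph n ^ n * ((3 * n * (n + 1) + 2) * (alph n / keys n + 1)) := by
  have h := card_filter_update (Collides (Z := Z) (D := D) hn J u j i) j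
    (m := (3 * n * (n + 1) + 2) * (alph n / keys n + 1)) ?_
  · simpa using h
  intro r
  by_cases hji : Near Z D n j i
  swap
  · rw [Finset.filter_false_of_mem fun a _ ha => hji ha.1]
    simp
  -- The secret at `j` enters only the symbol at `j`.
  have hsame : ∀ a, J i (encode hn u (Function.update r j a)) =
      J i (encode hn u r) := fun a => hJ i _ _ fun j' hj' => by
    have : j' ≠ j := fun h => near_of_le hd hji hj' (congrArg Fin.val h)
    simp only [encode, Function.update_of_ne this]
  cases he : J i (encode hn u r) with
  | none =>
    have hres : ∀ a, symRes n (received J (encode hn u (Function.update r j a)) i) =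
        number u % resMod n i := fun a => by
      simp only [received, hsame, he, Option.getD_none, encode]
      exact symRes_symbol _ _ i.2
    rw [Finset.filter_false_of_mem fun a _ ha => ha.2.1 (hres a)]
    exact Nat.zero_le _
  | some e =>
    by_cases hne : symRes n e = number u % resMod n i
    · have hres : ∀ a, symRes n (received J (encode hn u (Function.update r j a)) i) =
          number u % resMod n i := fun a => by
        simpa only [received, hsame, he, Option.getD_some] using hne
      rw [Finset.filter_false_of_mem fun a _ ha => ha.2.1 (hres a)]
      exact Nat.zero_le _
    · let K := (Finset.range (keys n)).filter fun κ =>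
        symRes n e % tagMod n κ = number u % resMod n i % tagMod n κ
      have hK : K.card ≤ 3 * n * (n + 1) + 2 :=
        card_keys_le (Nat.mod_lt _ (resBound_pos n)) (mod_resMod_lt _ i.2) hne
      refine le_trans (Finset.card_le_card fun a ha => ?_) ((card_filter_mod_le (q := alph n)
        (F := keys n) K).trans (Nat.mul_le_mul_right _ hK))
      have h1 := (Finset.mem_filter.1 ha).2.2.2
      simp only [received, hsame, he, Option.getD_some, Function.update_self] at h1
      exact Finset.mem_filter.2 ⟨Finset.mem_univ _, Finset.mem_filter.2
        ⟨Finset.mem_range.2 (Nat.mod_lt _ (keys_pos hn)), h1⟩⟩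

theorem card_unchanged_ge {p : ℝ} (hp : p * Z ≤ P) {J : Jammer n (alph n)}
    {c : Code n (alph n)} (hJ : HasPower p c J) (u : Fin c.k → Fin (alph n))
    (r : Fin c.l → Fin (alph n)) :
    Z * n ≤ Z * (Finset.univ.filter fun i : Fin n =>
      received J (c.enc u r) i = c.enc u r i).card + P * n := by
  have h1 := hJ u r
  have h2 := Finset.card_filter_add_card_filter_not (s := Finset.univ) (fun i : Fin n =>
      received J (c.enc u r) i = c.enc u r i)
  rw [hammingDist] at h1
  simp only [Finset.card_univ, Fintype.card_fin] at h2
  simp only [ne_eq] at h1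
  generalize (Finset.univ.filter fun i : Fin n =>
      received J (c.enc u r) i = c.enc u r i).card = a at *
  generalize (Finset.univ.filter fun i : Fin n =>
      ¬ received J (c.enc u r) i = c.enc u r i).card = b at *
  have h3 : (Z : ℝ) * b ≤ P * n := by
    calc (Z : ℝ) * b ≤ Z * (p * n) := mul_le_mul_of_nonneg_left h1 (Nat.cast_nonneg _)
      _ = p * Z * n := by ring
      _ ≤ P * n := mul_le_mul_of_nonneg_right hp (Nat.cast_nonneg _)
  have h4 : Z * b ≤ P * n := by exact_mod_cast h3
  rw [← h2, Nat.mul_add]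
  rw [← h2] at h4
  omega

theorem number_lt {m q : ℕ} (u : Fin m → Fin q) : number u < q ^ m :=
  sum_digits_lt fun _ hi => ext_lt u hi

theorem digit_number {m q : ℕ} (u : Fin m → Fin q) (i : Fin m) :
    number u / q ^ (i : ℕ) % q = u i := by
  rw [number, sum_digits_div_mod (fun _ hj => ext_lt u hj) i.2, ext_val]

theorem dec_eq (hD : 0 < D) (hDP : D ≤ P) (hPZ : 2 * P < Z) (hlen : 3 ≤ n * (Z + D - 2 * P) / Z)
    {p : ℝ} (hp : p * Z ≤ P) {J : Jammer n (alph n)} (hJ : HasPower p (code Z P D hn) J)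
    (u : Fin (msgLen Z P D n) → Fin (alph n)) (r : Fin n → Fin (alph n)) (s : Fin 0 → Fin (alph n))
    (h : ∀ j i, ¬ Collides (Z := Z) (D := D) hn J u j i r) :
    (code Z P D hn).dec (received J ((code Z P D hn).enc u r)) s = u := by
  set y := received J ((code Z P D hn).enc u r) with hy
  let T : Finset ℕ := (Finset.univ.filter fun i : Fin n =>
      y i = (code Z P D hn).enc u r i).map Fin.valEmbedding
  have hT : ∀ j ∈ T, ∃ hj : j < n, y ⟨j, hj⟩ = (code Z P D hn).enc u r ⟨j, hj⟩ := fun j hj => by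
    obtain ⟨i, hi, rfl⟩ := Finset.mem_map.1 hj
    exact ⟨i.2, (Finset.mem_filter.1 hi).2⟩
  have hdec : decode Z P D n (ext y) = number u := by
    refine decode_eq hD hDP hPZ hlen (number_lt u) (κ := fun j => ext r j % keys n) (T := T)
      (fun j hj => Finset.mem_range.2 (hT j hj).1) ?_ (fun j _ => Nat.mod_lt _ (keys_pos hn))
      (fun j hj => ?_) (fun j hj i hi hji heq => ?_)
    · rw [Finset.card_map]
      exact card_unchanged_ge hp hJ u r
    · obtain ⟨hjn, h1⟩ := hT j hj
      rw [ext, dif_pos hjn, h1]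
      simp [code, encode, ext, hjn]
    · obtain ⟨hjn, -⟩ := hT j hj
      by_contra hne
      refine h ⟨j, hjn⟩ ⟨i, hi⟩ ⟨hji, ?_, ?_⟩
      · have h1 : symRes n (y ⟨i, hi⟩) ≠ number u % resMod n i := by simpa [ext, hi] using hne
        exact h1
      · have h1 : symRes n (y ⟨i, hi⟩) % tagMod n (r ⟨j, hjn⟩ % keys n) =
          number u % resMod n i % tagMod n (r ⟨j, hjn⟩ % keys n) := by
          simpa [ext, hi, hjn] using heq
        exact h1
  funext i
  apply Fin.ext
  simp only [code, hdec]
  exact digit_number u i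

/-- Union bound over `n ^ 2` pairs of positions. Each pair collides with probability at most `2 * (8
* n ^ 2) / n ^ 5`, which leaves `16 / n` in total. -/
theorem code_reliable (hD : 0 < D) (hDP : D ≤ P) (hPZ : 2 * P < Z)
    (hlen : 3 ≤ n * (Z + D - 2 * P) / Z) {p d ε : ℝ} (hp : p * Z ≤ P) (hd : (D : ℝ) ≤ d * Z)
    (hε : 16 / (n : ℝ) ≤ ε) : (code Z P D hn).Reliable p d ε := by
  refine Code.reliable_of_forall fun J hJd hJp u => le_trans ?_ hε
  let u' : Fin (msgLen Z P D n) → Fin (alph n) := u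
  have hq := alph_pos n
  have hF := keys_pos hn
  let bad : Finset (Fin n → Fin (alph n)) := Finset.univ.biUnion fun ji : Fin n × Fin n =>
    Finset.univ.filter (Collides (Z := Z) (D := D) hn J u' ji.1 ji.2)
  have hbad : alph n * bad.card ≤
      n * n * (alph n ^ n * ((3 * n * (n + 1) + 2) * (alph n / keys n + 1))) := by
    calc alph n * bad.card ≤ alph n * ∑ ji : Fin n × Fin n, (Finset.univ.filter
          (Collides (Z := Z) (D := D) hn J u' ji.1 ji.2)).card :=
          Nat.mul_le_mul_left _ Finset.card_biUnion_le
      _ = ∑ ji : Fin n × Fin n, alph n * (Finset.univ.filter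
          (Collides (Z := Z) (D := D) hn J u' ji.1 ji.2)).card := Finset.mul_sum _ _ _
      _ ≤ ∑ _ji : Fin n × Fin n, alph n ^ n * ((3 * n * (n + 1) + 2) * (alph n / keys n + 1)) :=
          Finset.sum_le_sum fun ji _ => card_collides_le hn hd hJd u' ji.1 ji.2
      _ = _ := by simp
  have hsub : (Finset.univ.filter fun z : (Fin (code Z P D hn).l → Fin (alph n)) ×
      (Fin (code Z P D hn).b → Fin (alph n)) =>
      (code Z P D hn).dec (received J ((code Z P D hn).enc u z.1)) z.2 ≠ u).card ≤ bad.card := by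
    refine Finset.card_le_card_of_injOn Prod.fst (fun z hz => ?_) fun z _ z' _ hzz =>
      Prod.ext hzz (funext fun i : Fin 0 => i.elim0)
    have hz' := (Finset.mem_filter.1 (Finset.mem_coe.1 hz)).2
    by_contra hcon
    refine hz' (dec_eq hn hD hDP hPZ hlen hp hJp u z.1 z.2 fun j i hji => hcon ?_)
    exact Finset.mem_coe.2 (Finset.mem_biUnion.2 ⟨(j, i), Finset.mem_univ _,
      Finset.mem_filter.2 ⟨Finset.mem_univ _, hji⟩⟩)
  have hcard : Fintype.card ((Fin n → Fin (alph n)) × (Fin 0 → Fin (alph n))) = alph n ^ n := by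
    simp
  have hfin : n * bad.card ≤ 16 * alph n ^ n := by
    -- The key is nearly uniform: there are no more keys than symbols, so the incomplete period
    -- costs at most a factor of two.
    have hFq : keys n * (alph n / keys n + 1) ≤ 2 * alph n := by
      have h1 := Nat.mul_div_le (alph n) (keys n)
      have h2 : keys n ≤ alph n := by
        refine (keys_lt_base n).le.trans ?_
        rw [alph, block, ← pow_mul]
        exact Nat.le_self_pow (by positivity) _
      rw [Nat.mul_add]
      omega
    have h8 : 3 * n * (n + 1) + 2 ≤ 8 * n ^ 2 := by nlinarith
    have h3 : keys n * alph n * bad.card ≤ n * n * alph n ^ n * (8 * n ^ 2) * (2 * alph n) := by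
      calc keys n * alph n * bad.card = keys n * (alph n * bad.card) := by ring
        _ ≤ keys n * (n * n * (alph n ^ n * ((3 * n * (n + 1) + 2) * (alph n / keys n + 1)))) :=
          Nat.mul_le_mul_left _ hbad
        _ = n * n * alph n ^ n * (3 * n * (n + 1) + 2) * (keys n * (alph n / keys n + 1)) := by ring
        _ ≤ n * n * alph n ^ n * (8 * n ^ 2) * (2 * alph n) := by gcongr
    have h4 : (n ^ 4 * alph n) * (n * bad.card) ≤ (n ^ 4 * alph n) * (16 * alph n ^ n) := by
      calc (n ^ 4 * alph n) * (n * bad.card) = keys n * alph n * bad.card := by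
            rw [keys]; ring
        _ ≤ _ := h3
        _ = _ := by ring
    exact Nat.le_of_mul_le_mul_left h4 (by positivity)
  have h5 : errorProbOf (code Z P D hn) J u ≤ (bad.card : ℝ) / (alph n ^ n : ℕ) := by
    rw [errorProbOf]
    have h6 : Fintype.card ((Fin (code Z P D hn).l → Fin (alph n)) ×
        (Fin (code Z P D hn).b → Fin (alph n))) = alph n ^ n := hcard
    rw [h6]
    gcongr
  refine h5.trans ?_
  have hnr : (0 : ℝ) < n := by exact_mod_cast hn
  rw [div_le_div_iff₀ (by positivity) hnr]
  have : (n * bad.card : ℝ) ≤ (16 * alph n ^ n : ℕ) := by exact_mod_cast hfin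
  push_cast at this ⊢
  linarith

end Reliable

/-! ### The programs -/

section Programs

variable {α : Type} [Env α]

theorem small_keys : Small fun e : α => keys (blk e) := Small.blk.pow 5

theorem poly_base : Poly fun e : α => base (blk e) := (Small.lit 2).poly.pow (small_keys.pow 2)

theorem poly_tagStep : Poly fun e : α => (keys (blk e)).factorial * base (blk e) :=
  (Poly.factorial small_keys).mul poly_base

theorem poly_tagMod {κ : α → ℕ} (hκ : Poly κ) : Poly fun e => tagMod (blk e) (κ e) :=
  (Small.lit 1).poly.add ((hκ.add (Small.lit 1).poly).mul poly_tagStep)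

theorem poly_tagBound : Poly fun e : α => tagBound (blk e) := poly_base.pow (Small.lit 3)

theorem poly_block : Poly fun e : α => block (blk e) :=
  poly_base.pow ((Small.lit 3).mul (Small.blk.add (Small.lit 1)))

theorem poly_alph : Poly fun e : α => alph (blk e) :=
  poly_block.pow (Small.blk.add (Small.lit 1))

theorem poly_resStep : Poly fun e : α => resStep (blk e) :=
  (Poly.factorial small_keys).mul (poly_block.pow Small.blk)

theorem poly_resMod {i : α → ℕ} (hi : Poly i) : Poly fun e => resMod (blk e) (i e) :=
  (Small.lit 1).poly.add ((hi.add (Small.lit 1).poly).mul poly_resStep)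

theorem poly_resBound : Poly fun e : α => resBound (blk e) :=
  (poly_base.pow (Small.lit 2)).mul (poly_block.pow Small.blk)

theorem small_msgLen (Z P D : ℕ) : Small fun e : α => msgLen Z P D (blk e) :=
  ((Small.blk.mul (Small.lit (Z + D - 2 * P))).div (Small.lit Z).poly).sub (Small.lit 3).poly

theorem poly_symbol {U κ i : α → ℕ} (hU : Poly U) (hκ : Poly κ) (hi : Poly i) :
    Poly fun e => symbol (blk e) (U e) (κ e) (i e) :=
  (hU.mod (poly_resMod hi)).add (poly_resBound.mul (hκ.add (small_keys.poly.mul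
    (Poly.sum (N := blk) (f := fun e j => U e % resMod (blk e) j % tagMod (blk e) (κ e) *
      tagBound (blk e) ^ j) Small.blk
      (((hU.fst.mod (poly_resMod (α := α × ℕ) Small.idx.poly)).mod
        (poly_tagMod (α := α × ℕ) hκ.fst)).mul
        ((poly_tagBound (α := α × ℕ)).pow Small.idx))))))

/-- The symbol at position `i` of the word in the cells `1, …, n`. -/
def cell (m : Mem) (i : ℕ) : ℕ := if i < m 0 then m ((1 + i) % (4 * m 0)) else 0

theorem poly_cell {i : α → ℕ} (hi : Poly i) : Poly fun e => cell (Env.mem e) (i e) :=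
  Poly.ite (Small.lt hi Small.blk.poly) (Poly.rd ((Small.lit 1).poly.add hi)) (Small.lit 0).poly

theorem poly_symRes {s : α → ℕ} (hs : Poly s) : Poly fun e => symRes (blk e) (s e) :=
  hs.mod poly_resBound

theorem poly_symKey {s : α → ℕ} (hs : Poly s) : Poly fun e => symKey (blk e) (s e) :=
  (hs.div poly_resBound).mod small_keys.poly

theorem poly_symTag {s j : α → ℕ} (hs : Poly s) (hj : Small j) :
    Poly fun e => symTag (blk e) (s e) (j e) :=
  (((hs.div poly_resBound).div small_keys.poly).div (poly_tagBound.pow hj)).mod poly_tagBound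

theorem small_accepts {j i : α → ℕ} (hj : Poly j) (hi : Small i) :
    Small fun e => if Accepts (blk e) (cell (Env.mem e)) (j e) (i e) then 1 else 0 :=
  Small.eq ((poly_symRes (poly_cell hi.poly)).mod (poly_tagMod (poly_symKey (poly_cell hj))))
    (poly_symTag (poly_cell hj) hi)

theorem small_near (Z D : ℕ) {j i : α → ℕ} (hj : Poly j) (hi : Poly i) :
    Small fun e => if Near Z D (blk e) (j e) (i e) then 1 else 0 :=
  Small.lt ((Small.lit Z).poly.mul hi)
    (((Small.lit Z).poly.mul hj).add ((Small.lit D).mul Small.blk).poly)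

theorem small_selected (Z D : ℕ) {j i : α → ℕ} (hj : Poly j) (hi : Small i) :
    Small fun e => if Near Z D (blk e) (j e) (i e) ∧
      Accepts (blk e) (cell (Env.mem e)) (j e) (i e) then 1 else 0 :=
  (small_near Z D hj hi.poly).and (small_accepts hj hi)

theorem poly_idem {i j : α → ℕ} (hi : Poly i) (hj : Poly j) :
    Poly fun e => idem (blk e) (i e) (j e) :=
  ((((poly_resMod hj).mul ((hi.add (Small.lit 1).poly).pow (Small.lit 2))).mul
    (poly_resStep.div ((hi.sub hj).add (hj.sub hi)))).pow (Small.lit 2))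

/-- Loops of length `n` nested to depth two around closed arithmetic expressions. -/
theorem poly_cand (Z D : ℕ) {g : α → ℕ} (hg : Poly g) :
    Poly fun e => cand Z D (blk e) (cell (Env.mem e)) (g e) := by
  refine Poly.mod (Poly.sum Small.blk (Poly.ite (α := α × ℕ)
    (small_selected (α := α × ℕ) Z D hg.fst Small.idx)
    ((poly_symRes (α := α × ℕ) (poly_cell (α := α × ℕ) Small.idx.poly)).mul ?_)
    (Small.lit 0).poly))
    (Poly.prod Small.blk (Poly.ite (α := α × ℕ)
      (small_selected (α := α × ℕ) Z D hg.fst Small.idx)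
      (poly_resMod (α := α × ℕ) Small.idx.poly) (Small.lit 1).poly))
  exact Poly.prod (α := α × ℕ) (N := fun e => blk e.1) Small.blk
    (Poly.ite (α := (α × ℕ) × ℕ)
      ((small_selected (α := (α × ℕ) × ℕ) Z D hg.fst.fst Small.idx).and
        (Small.eq (α := (α × ℕ) × ℕ) Small.idx.poly Small.idx.poly.fst).not)
      (poly_idem (α := (α × ℕ) × ℕ) Small.idx.poly.fst Small.idx.poly) (Small.lit 1).poly)

theorem small_agrees {U i : α → ℕ} (hU : Poly U) (hi : Poly i) :
    Small fun e => if Agrees (blk e) (cell (Env.mem e)) (U e) (i e) then 1 else 0 :=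
  Small.eq (poly_symRes (poly_cell hi)) (hU.mod (poly_resMod hi))

theorem small_supports (Z D : ℕ) {U j : α → ℕ} (hU : Poly U) (hj : Poly j) :
    Small fun e => if Supports Z D (blk e) (cell (Env.mem e)) (U e) (j e) then 1 else 0 :=
  (small_agrees hU hj).and (Small.all (N := blk) Small.blk
    ((small_selected (α := α × ℕ) Z D hj.fst Small.idx).iff
      ((small_near (α := α × ℕ) Z D hj.fst Small.idx.poly).and
        (small_agrees (α := α × ℕ) hU.fst Small.idx.poly))))

theorem small_valid (Z P D : ℕ) {U : α → ℕ} (hU : Poly U) :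
    Small fun e => if Valid Z P D (blk e) (cell (Env.mem e)) (U e) then 1 else 0 :=
  (Small.lt hU (poly_alph.pow (small_msgLen Z P D))).and
    (Small.lt ((Small.lit Z).mul Small.blk).poly
      ((((Small.lit Z).poly.mul (Poly.sum (N := blk) Small.blk
        (small_supports (α := α × ℕ) Z D hU.fst Small.idx.poly).poly)).add
          ((Small.lit P).mul Small.blk).poly).add (Small.lit 1).poly))

theorem poly_decode (Z P D : ℕ) :
    Poly fun e : α => decode Z P D (blk e) (cell (Env.mem e)) :=
  Poly.div
    (Poly.sum (N := blk) Small.blk (Poly.ite (α := α × ℕ)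
      (small_valid (α := α × ℕ) Z P D (poly_cand (α := α × ℕ) Z D Small.idx.poly))
      (poly_cand (α := α × ℕ) Z D Small.idx.poly) (Small.lit 0).poly))
    (Poly.sum (N := blk) Small.blk
      (small_valid (α := α × ℕ) Z P D (poly_cand (α := α × ℕ) Z D Small.idx.poly)).poly)

/-- The message number in the encoder's input. -/
def inputNumber (Z P D : ℕ) (m : Mem) : ℕ :=
  ∑ i ∈ Finset.range (msgLen Z P D (m 0)), m ((1 + i) % (4 * m 0)) * alph (m 0) ^ i

theorem poly_inputNumber (Z P D : ℕ) : Poly fun e : α => inputNumber Z P D (Env.mem e) :=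
  Poly.sum (N := fun e => msgLen Z P D (blk e)) (small_msgLen Z P D)
    ((Poly.rd (α := α × ℕ) ((Small.lit 1).poly.add Small.idx.poly)).mul
      ((poly_alph (α := α × ℕ)).pow Small.idx))

/-- The number whose digits form the transmitted word. -/
def wordNumber (Z P D : ℕ) (m : Mem) : ℕ :=
  ∑ i ∈ Finset.range (m 0), symbol (m 0) (inputNumber Z P D m)
    (m ((1 + msgLen Z P D (m 0) + i) % (4 * m 0)) % keys (m 0)) i * alph (m 0) ^ i

theorem poly_wordNumber (Z P D : ℕ) : Poly fun e : α => wordNumber Z P D (Env.mem e) :=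
  Poly.sum (N := blk) Small.blk
    ((poly_symbol (α := α × ℕ) (poly_inputNumber (α := α × ℕ) Z P D)
      ((Poly.rd (α := α × ℕ) (((Small.lit 1).poly.add (small_msgLen (α := α × ℕ) Z P D).poly).add
        Small.idx.poly)).mod (small_keys (α := α × ℕ)).poly) Small.idx.poly).mul
      ((poly_alph (α := α × ℕ)).pow Small.idx))

end Programs

/-! ### Running times -/

/-- The initial memory. -/
def input (n : ℕ) (xs : List ℕ) : Mem := fun a => (n :: xs).getD a 0

theorem input_word_left {n a b q : ℕ} (x : Fin a → Fin q) (y : Fin b → Fin q) {i : ℕ}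
    (hi : i < a) : input n (word x ++ word y) (1 + i) = ext x i := by
  rw [add_comm]
  simp [input, word, ext, hi, List.getElem?_append]

theorem input_word_right {n a b q : ℕ} (x : Fin a → Fin q) (y : Fin b → Fin q) {i : ℕ}
    (hi : i < b) : input n (word x ++ word y) (1 + a + i) = ext y i := by
  rw [show 1 + a + i = (a + i) + 1 by omega]
  simp [input, word, ext, hi]

theorem input_le {n a b q : ℕ} (x : Fin a → Fin q) (y : Fin b → Fin q) (c : ℕ) :
    input n (word x ++ word y) c ≤ max n q := by
  rcases Nat.eq_zero_or_pos c with rfl | hc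
  · exact le_max_left _ _
  · obtain ⟨i, rfl⟩ : ∃ i, c = 1 + i := ⟨c - 1, by omega⟩
    refine le_trans ?_ (le_max_right _ _)
    by_cases h1 : i < a
    · rw [input_word_left x y h1]
      exact (ext_lt x h1).le
    · obtain ⟨j, rfl⟩ : ∃ j, i = a + j := ⟨i - a, by omega⟩
      rw [← add_assoc]
      by_cases h2 : j < b
      · rw [input_word_right x y h2]
        exact (ext_lt y h2).le
      · rw [show 1 + a + j = (a + j) + 1 by omega]
        have : ¬ j < b := h2
        simp [input, word, this]

theorem bdd_input {n a b q A : ℕ} (hn : 2 ≤ n) (hA : 1 ≤ A) (hq : q < 2 ^ n ^ A)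
    (x : Fin a → Fin q) (y : Fin b → Fin q) :
    Bdd A (input n (word x ++ word y)) := by
  refine ⟨hn, fun c => ?_, fun i hi => absurd hi (Nat.not_lt_zero i)⟩
  have hb : blk (input n (word x ++ word y)) = n := rfl
  rw [hb, Nat.size_le]
  refine (input_le x y c).trans_lt (max_lt ?_ hq)
  exact Nat.lt_two_pow_self.trans_le (Nat.pow_le_pow_right (by norm_num)
    (Nat.le_self_pow (by omega) n))

theorem msgLen_le {Z P D : ℕ} (hDP : D ≤ P) (hPZ : 2 * P < Z) (n : ℕ) : msgLen Z P D n ≤ n := by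
  refine (Nat.sub_le _ _).trans ((Nat.div_le_div_right
    (Nat.mul_le_mul_left n (by omega : Z + D - 2 * P ≤ Z))).trans ?_)
  rw [Nat.mul_div_cancel _ (by omega)]

theorem alph_eq (n : ℕ) : alph n = 2 ^ (keys n ^ 2 * (3 * (n + 1) * (n + 1))) := by
  rw [alph, block, base, ← pow_mul, ← pow_mul]

theorem alph_lt {n : ℕ} (hn : 2 ≤ n) : alph n < 2 ^ n ^ 20 := by
  rw [alph_eq]
  refine Nat.pow_lt_pow_right (by norm_num) ?_
  have h1 : 3 * (n + 1) * (n + 1) < n ^ 10 := by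
    have h2 : 2 ^ 6 ≤ n ^ 6 := Nat.pow_le_pow_left hn 6
    have h3 : 3 * (n + 1) * (n + 1) ≤ 3 * (2 * n) * (2 * n) := by gcongr <;> omega
    calc 3 * (n + 1) * (n + 1) ≤ 12 * n ^ 2 := h3.trans (by ring_nf; exact le_rfl)
      _ < 2 ^ 6 * n ^ 2 := by
          have : 0 < n ^ 2 := by positivity
          omega
      _ ≤ n ^ 6 * n ^ 2 := Nat.mul_le_mul_right _ h2
      _ = n ^ 8 := by ring
      _ ≤ n ^ 10 := Nat.pow_le_pow_right (by omega) (by norm_num)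
  calc keys n ^ 2 * (3 * (n + 1) * (n + 1)) = n ^ 10 * (3 * (n + 1) * (n + 1)) := by
        rw [keys]; ring
    _ < n ^ 10 * n ^ 10 := Nat.mul_lt_mul_of_pos_left h1 (by positivity)
    _ = n ^ 20 := by ring

theorem le_alph {n : ℕ} (hn : 1 ≤ n) : 2 ^ n ≤ alph n := by
  rw [alph_eq]
  refine Nat.pow_le_pow_right (by norm_num) ?_
  have h1 : 1 ≤ keys n ^ 2 := Nat.one_le_pow _ _ (keys_pos hn)
  nlinarith [Nat.mul_le_mul h1 (le_refl ((3 * (n + 1)) * (n + 1)))]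

theorem wordNumber_input {Z P D n : ℕ} (hn : 0 < n) (hk : msgLen Z P D n ≤ n)
    (u : Fin (msgLen Z P D n) → Fin (alph n)) (r : Fin n → Fin (alph n)) :
    wordNumber Z P D (input n (word u ++ word r)) = number (encode hn u r) := by
  have h0 : input n (word u ++ word r) 0 = n := rfl
  have hU : inputNumber Z P D (input n (word u ++ word r)) = number u := by
    unfold inputNumber number
    rw [h0]
    refine Finset.sum_congr rfl fun i hi => ?_
    have hi' := Finset.mem_range.1 hi
    rw [Nat.mod_eq_of_lt (by omega), input_word_left u r hi']
  unfold wordNumber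
  rw [hU, h0, number]
  refine Finset.sum_congr rfl fun i hi => ?_
  have hi' := Finset.mem_range.1 hi
  rw [Nat.mod_eq_of_lt (by omega : 1 + msgLen Z P D n + i < 4 * n), input_word_right u r hi']
  rw [ext, ext, dif_pos hi', dif_pos hi']
  rfl

theorem cell_input {n b q : ℕ} (y : Fin n → Fin q) (s : Fin b → Fin q) :
    cell (input n (word y ++ word s)) = ext y := by
  funext i
  have h0 : input n (word y ++ word s) 0 = n := rfl
  unfold cell
  rw [h0]
  by_cases hi : i < n
  · rw [if_pos hi, Nat.mod_eq_of_lt (by omega), input_word_left y s hi]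
  · rw [if_neg hi, ext, dif_neg hi]

theorem word_getD {m q : ℕ} (x : Fin m → Fin q) {i : ℕ} (hi : i < m) :
    (word x).getD i 0 = x ⟨i, hi⟩ := by
  simp [word, hi]

theorem digit_wordNumber {Z P D n : ℕ} (hn : 0 < n) (hk : msgLen Z P D n ≤ n)
    (u : Fin (msgLen Z P D n) → Fin (alph n)) (r : Fin n → Fin (alph n)) {i : ℕ} (hi : i < n) :
    wordNumber Z P D (input n (word u ++ word r)) / alph n ^ i % alph n =
      (word (encode hn u r)).getD i 0 := by
  rw [wordNumber_input hn hk, word_getD _ hi]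
  exact digit_number (encode hn u r) ⟨i, hi⟩

/-- `Z`, `P` and `D` occur in the programs as literals, so one pair of programs serves all block
lengths. The exponent `20` is that of `alph_lt`. -/
theorem exists_programs {Z P D : ℕ} (hDP : D ≤ P) (hPZ : 2 * P < Z) :
    ∃ (E F : Prog) (a : ℕ), ∀ (n : ℕ) (hn : 2 ≤ n),
      (code Z P D (by omega : 0 < n)).RunsIn E F (n ^ a) := by
  obtain ⟨E, hE⟩ := Poly.output (poly_wordNumber Z P D) poly_alph Small.blk
  obtain ⟨F, hF⟩ := Poly.output (poly_decode Z P D) poly_alph (small_msgLen Z P D)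
  obtain ⟨a, ha⟩ := hE 20
  obtain ⟨b, hb⟩ := hF 20
  refine ⟨E, F, a + b, fun n hn => ?_⟩
  have hn0 : 0 < n := by omega
  have hk := msgLen_le hDP hPZ n
  have hblk : ∀ xs, blk (input n xs) = n := fun _ => rfl
  have hmem : ∀ xs, Env.mem (input n xs) = input n xs := fun _ => rfl
  refine ⟨fun u r => ?_, fun y s => ?_⟩
  · obtain ⟨m', t, hx, ht, hd⟩ := ha _ (bdd_input hn (by norm_num) (alph_lt hn) u r) le_rfl
    refine ⟨m', t, hx, ht.trans (Nat.pow_le_pow_right hn0 (Nat.le_add_right _ _)), fun i hi => ?_⟩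
    have hi' : i < n := by simpa [word] using hi
    exact (hd i hi').trans (digit_wordNumber hn0 hk u r hi')
  · obtain ⟨m', t, hx, ht, hd⟩ := hb _ (bdd_input hn (by norm_num) (alph_lt hn) y s) hk
    refine ⟨m', t, hx, ht.trans (Nat.pow_le_pow_right hn0 (Nat.le_add_left _ _)), fun i hi => ?_⟩
    have hi' : i < msgLen Z P D n := by simpa [word, code] using hi
    rw [hd i hi', hblk, hmem, cell_input]
    exact (word_getD ((code Z P D hn0).dec y s) hi').symm

/-! ### Efficient codes -/

/-- Rational parameters turn all comparisons made by the decoder into integer ones. Rounding costs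
fewer than four message symbols, which the term `δ / 2` absorbs. -/
theorem efficientlyAchievable_of_rational {Z P D : ℕ} (hD : 0 < D) (hDP : D ≤ P) (hPZ : 2 * P < Z)
    {p d R ε δ : ℝ} (hp : p * Z ≤ P) (hd : (D : ℝ) ≤ d * Z) (hε : 0 < ε) (hδ : 0 < δ)
    (hR : (R - δ) * Z + δ / 2 * Z ≤ (Z : ℝ) + D - 2 * P) :
    ∃ (E F : Prog) (a N : ℕ), ∀ n : ℕ, N ≤ n →
      ∃ q : ℕ, IsPrimePow q ∧ 2 ^ n ≤ q ∧ q ≤ 2 ^ (n ^ a) ∧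
        ∃ c : Code n q, (R - δ) * n ≤ c.k ∧ c.Reliable p d ε ∧
          c.l ≤ n ^ a ∧ c.b ≤ n ^ a ∧ c.RunsIn E F (n ^ a) := by
  obtain ⟨E, F, a, hrun⟩ := exists_programs hDP hPZ
  obtain ⟨M1, hM1⟩ := exists_nat_gt (16 / ε)
  obtain ⟨M2, hM2⟩ := exists_nat_gt (8 / δ)
  -- `M1` makes `16 / n` at most `ε`, `M2` makes `δ * n / 2` at least four, and `4 * Z` guarantees
  -- `hlen`.
  refine ⟨E, F, a + 20, M1 + M2 + 4 * Z + 2, fun n hn => ?_⟩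
  have hn2 : 2 ≤ n := by omega
  have hn0 : 0 < n := by omega
  have hnr : (0 : ℝ) < n := by exact_mod_cast hn0
  have hZ : 0 < Z := by omega
  have hZr : (0 : ℝ) < Z := by exact_mod_cast hZ
  have hmono : ∀ {b}, b ≤ a + 20 → n ^ b ≤ n ^ (a + 20) := fun h => Nat.pow_le_pow_right hn0 h
  have hM1' : (M1 : ℝ) ≤ n := by exact_mod_cast (by omega : M1 ≤ n)
  have hM2' : (M2 : ℝ) ≤ n := by exact_mod_cast (by omega : M2 ≤ n)
  have hlen : 3 ≤ n * (Z + D - 2 * P) / Z := by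
    rw [Nat.le_div_iff_mul_le hZ]
    have : 3 * Z ≤ n := by omega
    exact this.trans (Nat.le_mul_of_pos_right n (by omega))
  refine ⟨alph n, ?_, le_alph hn0, (alph_lt hn2).le.trans (Nat.pow_le_pow_right (by norm_num)
    (hmono (by omega))), code Z P D hn0, ?_, ?_, ?_, Nat.zero_le _, ?_⟩
  · rw [alph_eq]
    refine (isPrimePow_nat_iff _).2 ⟨2, _, Nat.prime_two, ?_, rfl⟩
    have := keys_pos hn0
    positivity
  · have h1 : n * (Z + D - 2 * P) < Z * (msgLen Z P D n + 4) := by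
      have h2 := Nat.lt_mul_div_succ (n * (Z + D - 2 * P)) hZ
      have h3 : msgLen Z P D n + 4 = n * (Z + D - 2 * P) / Z + 1 := by unfold msgLen; omega
      rw [h3]
      exact h2
    have h4 : (n : ℝ) * (Z + D - 2 * P) < Z * (msgLen Z P D n + 4) := by
      have : ((n * (Z + D - 2 * P) : ℕ) : ℝ) < ((Z * (msgLen Z P D n + 4) : ℕ) : ℝ) := by
        exact_mod_cast h1
      rw [Nat.cast_mul, Nat.cast_sub (by omega)] at this
      push_cast at this
      exact this
    have h5 : 8 ≤ δ * n := by
      rw [div_lt_iff₀ hδ] at hM2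
      nlinarith
    have h6 : (n : ℝ) * ((R - δ) * Z + δ / 2 * Z) ≤ n * (Z + D - 2 * P) :=
      mul_le_mul_of_nonneg_left hR hnr.le
    have h7 : (Z : ℝ) * ((R - δ) * n + δ * n / 2) < Z * (msgLen Z P D n + 4) := by
      refine lt_of_le_of_lt (le_of_eq ?_) (h6.trans_lt h4)
      ring
    have h8 := lt_of_mul_lt_mul_left h7 hZr.le
    change (R - δ) * n ≤ (msgLen Z P D n : ℝ)
    linarith
  · refine code_reliable hn0 hD hDP hPZ hlen hp hd ?_
    rw [div_le_iff₀ hnr]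
    rw [div_lt_iff₀ hε] at hM1
    nlinarith
  · change n ≤ _
    exact Nat.le_self_pow (by omega) n
  · obtain ⟨h1, h2⟩ := hrun n hn2
    refine ⟨fun u r => ?_, fun y s => ?_⟩
    · obtain ⟨m, t, hx, ht, hm⟩ := h1 u r
      exact ⟨m, t, hx, ht.trans (hmono (by omega)), hm⟩
    · obtain ⟨m, t, hx, ht, hm⟩ := h2 y s
      exact ⟨m, t, hx, ht.trans (hmono (by omega)), hm⟩

/-- Two positive rationals have a common denominator. -/
theorem exists_common_denominator {x y : ℚ} (hx : 0 < x) (hy : 0 < y) :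
    ∃ Z P D : ℕ, 0 < Z ∧ (P : ℝ) = x * Z ∧ (D : ℝ) = y * Z := by
  refine ⟨x.den * y.den, x.num.toNat * y.den, y.num.toNat * x.den, by positivity, ?_, ?_⟩
  · have h1 : (x.num.toNat : ℝ) = x.num := by
      exact_mod_cast Int.toNat_of_nonneg (Rat.num_pos.2 hx).le
    have h2 : (x : ℝ) = x.num / x.den := by exact_mod_cast (Rat.num_div_den x).symm
    have h3 : (x.den : ℝ) ≠ 0 := by exact_mod_cast x.den_nz
    push_cast
    rw [h1, h2]
    field_simp
  · have h1 : (y.num.toNat : ℝ) = y.num := by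
      exact_mod_cast Int.toNat_of_nonneg (Rat.num_pos.2 hy).le
    have h2 : (y : ℝ) = y.num / y.den := by exact_mod_cast (Rat.num_div_den y).symm
    have h3 : (y.den : ℝ) ≠ 0 := by exact_mod_cast y.den_nz
    push_cast
    rw [h1, h2]
    field_simp

/-- A code for a larger power `x` and a smaller delay `y` also withstands power `p` and delay `d`,
so rational approximations from these sides suffice. -/
theorem efficientlyAchievable_of_approx {p d R : ℝ}
    (h : ∀ δ : ℝ, 0 < δ → ∃ x y : ℚ, 0 < y ∧ y ≤ x ∧ (x : ℝ) < 1 / 2 ∧ p ≤ x ∧ (y : ℝ) ≤ d ∧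
      R - δ ≤ 1 - 2 * x + y) : EfficientlyAchievable p d R := by
  intro ε hε δ hδ
  obtain ⟨x, y, hy, hyx, hx2, hpx, hyd, hR⟩ := h (δ / 2) (half_pos hδ)
  obtain ⟨Z, P, D, hZ, hP, hD⟩ := exists_common_denominator (hy.trans_le hyx) hy
  have hZr : (0 : ℝ) < Z := by exact_mod_cast hZ
  have hyr : (0 : ℝ) < y := by exact_mod_cast hy
  have hyxr : (y : ℝ) ≤ x := by exact_mod_cast hyx
  have h1 : 0 < D := by
    have : (0 : ℝ) < D := by rw [hD]; positivity
    exact_mod_cast this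
  have h2 : D ≤ P := by
    have : (D : ℝ) ≤ P := by rw [hD, hP]; gcongr
    exact_mod_cast this
  have h3 : 2 * P < Z := by
    have : 2 * (P : ℝ) < Z := by rw [hP]; nlinarith
    exact_mod_cast this
  refine efficientlyAchievable_of_rational h1 h2 h3 ?_ ?_ hε hδ ?_
  · rw [hP]; gcongr
  · rw [hD]; gcongr
  · rw [hP, hD]
    have := mul_le_mul_of_nonneg_right hR hZr.le
    linarith

end OnlineChannel

/-! ### The capacity in the three regimes -/

theorem theorem3 (p d : ℝ) (hp0 : 0 ≤ p) (hp1 : p ≤ 1) (hd : 0 < d) :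
    (p < 1 / 2 → p < d →
      OnlineChannel.IsCapacity p d (1 - p) ∧
        OnlineChannel.EfficientlyAchievable p d (1 - p)) ∧
    (p < 1 / 2 → d < p →
      OnlineChannel.IsCapacity p d (1 - 2 * p + d) ∧
        OnlineChannel.EfficientlyAchievable p d (1 - 2 * p + d)) ∧
    (1 / 2 ≤ p →
      OnlineChannel.IsCapacity p d 0 ∧
        OnlineChannel.EfficientlyAchievable p d 0) := by
  refine ⟨fun hp2 hpd => ?_, fun hp2 hdp => ?_, fun hp2 => ?_⟩
  · have h : OnlineChannel.EfficientlyAchievable p d (1 - p) := by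
      refine OnlineChannel.efficientlyAchievable_of_approx fun δ hδ => ?_
      -- Below the delay, `y = x` is allowed, and `1 - 2 * x + y` becomes `1 - x`.
      obtain ⟨x, hx1, hx2⟩ := exists_rat_btwn
        (lt_min (lt_min hp2 hpd) (lt_add_of_pos_right p hδ))
      have hx3 := hx2.trans_le (min_le_left _ _)
      have hx4 := hx2.trans_le (min_le_right _ _)
      have hx5 : (0 : ℝ) < x := hp0.trans_lt hx1
      exact ⟨x, x, by exact_mod_cast hx5, le_rfl, hx3.trans_le (min_le_left _ _), hx1.le,
        (hx3.trans_le (min_le_right _ _)).le, by linarith⟩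
    exact ⟨h.isCapacity (by linarith) fun R hR => hR.le_one_sub hp0 hp1, h⟩
  · have h : OnlineChannel.EfficientlyAchievable p d (1 - 2 * p + d) := by
      refine OnlineChannel.efficientlyAchievable_of_approx fun δ hδ => ?_
      -- Errors of `δ / 4` in `x`, counted twice, and of `δ / 4` in `y` stay below `δ`.
      obtain ⟨x, hx1, hx2⟩ := exists_rat_btwn
        (lt_min hp2 (lt_add_of_pos_right p (by positivity : 0 < δ / 4)))
      obtain ⟨y, hy1, hy2⟩ := exists_rat_btwn
        (max_lt hd (sub_lt_self d (by positivity : 0 < δ / 4)))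
      have hx3 := hx2.trans_le (min_le_left _ _)
      have hx4 := hx2.trans_le (min_le_right _ _)
      have hy3 := (le_max_left _ _).trans_lt hy1
      have hy4 := (le_max_right _ _).trans_lt hy1
      have hyx : (y : ℝ) ≤ x := by linarith
      exact ⟨x, y, by exact_mod_cast hy3, by exact_mod_cast hyx, hx3, hx1.le, hy2.le,
        by linarith⟩
    exact ⟨h.isCapacity (by linarith) fun R hR => hR.le_of_delay hd hdp hp2, h⟩
  · have h := OnlineChannel.efficientlyAchievable_zero p d
    exact ⟨h.isCapacity le_rfl fun R hR => hR.le_zero hp2, h⟩
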